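/- Let $\Sigma$ be a compact connected Riemann surface and let $f:\Sigma\to\Sigma$ be an anti-holomorphic involution, so that $\mathbb{Z}_2$ acts on $\Sigma$ by $f$. A $\mathbb{Z}_2$-equivariant vector bundle on $\Sigma$ is a (topological, finite rank) complex vector bundle $V\to\Sigma$ together with a continuous, fibrewise complex linear map $\varphi:V\to V$ covering $f$ with $\varphi^2=\mathrm{id}$; an isomorphism $(V,\varphi)\cong(V',\varphi')$ is an isomorphism $\alpha: V\to V'$ of complex vector bundles over $\mathrm{id}_\Sigma$ with $\alpha\varphi=\varphi'\alpha$. Let $K^0_{\mathbb{Z}_2}(\Sigma)$ be the Grothendieck group of the commutative monoid of isomorphism classes of $\mathbb{Z}_2$-equivariant vector bundles on $\Sigma$ under direct sum, and let $[V]$ denote the class of $V$ in it. **Proposition 4.1.** Let $V$ and $V'$ be $\mathbb{Z}_2$-equivariant vector bundles on $\Sigma$. Then $V$ and $V'$ are isomorphic as equivariant vector bundles if and only if $[V]=[V']$ in $K^0_{\mathbb{Z}_2}(\Sigma)$. -/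

import Mathlib

open Bundle Topology
open scoped Manifold ContDiff

universe u v

noncomputable section

/-- A map `f : S → S` of a Riemann surface is antiholomorphic if it is continuous and, read in any
two holomorphic charts, its complex conjugate is holomorphic. -/
def IsAntiholomorphic {S : Type u} [TopologicalSpace S] [ChartedSpace ℂ S] (f : S → S) : Prop :=
  Continuous f ∧ ∀ e ∈ atlas ℂ S, ∀ e' ∈ atlas ℂ S,
    DifferentiableOn ℂ (fun z : ℂ => (starRingEnd ℂ) (e' (f (e.symm z))))
      {z | z ∈ e.target ∧ f (e.symm z) ∈ e'.source}

/-- A continuous involution of a space `X`, that is, a continuous action of `ℤ₂` on `X`. -/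
structure ContinuousInvolution (X : Type u) [TopologicalSpace X] where
  /-- the action of the generator -/
  toFun : X → X
  continuous_toFun : Continuous toFun
  involutive : Function.Involutive toFun

variable {X : Type u} [TopologicalSpace X]

/-- A `ℤ₂`-equivariant (topological) complex vector bundle of finite rank over `X`, where `ℤ₂` acts
on `X` by the involution `f`: a complex vector bundle `fiber` with finite-dimensional model fibre
`F`, and a fibrewise complex linear, continuous involution of its total space that covers `f`. -/
structure EquivariantBundle (f : ContinuousInvolution X) where
  /-- the model fibre -/
  F : Type v
  [normedAddCommGroup : NormedAddCommGroup F]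
  [normedSpace : NormedSpace ℂ F]
  [finiteDimensional : FiniteDimensional ℂ F]
  /-- the fibres of the bundle -/
  fiber : X → Type v
  [addCommGroup : ∀ x, AddCommGroup (fiber x)]
  [module : ∀ x, Module ℂ (fiber x)]
  [topologicalSpaceFiber : ∀ x, TopologicalSpace (fiber x)]
  [topologicalSpaceTotal : TopologicalSpace (TotalSpace F fiber)]
  [fiberBundle : FiberBundle F fiber]
  [vectorBundle : VectorBundle ℂ F fiber]
  /-- the lift of the involution to the fibres -/
  lift : ∀ x, fiber x →ₗ[ℂ] fiber (f.toFun x)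
  continuous_lift : Continuous
    (fun p : TotalSpace F fiber => (⟨f.toFun p.proj, lift p.proj p.snd⟩ : TotalSpace F fiber))
  involutive_lift : Function.Involutive
    (fun p : TotalSpace F fiber => (⟨f.toFun p.proj, lift p.proj p.snd⟩ : TotalSpace F fiber))

namespace EquivariantBundle

attribute [instance] normedAddCommGroup normedSpace finiteDimensional addCommGroup module
  topologicalSpaceFiber topologicalSpaceTotal fiberBundle vectorBundle

variable {f : ContinuousInvolution X}

/-- The total space of an equivariant bundle. -/
abbrev Total (V : EquivariantBundle.{u, v} f) : Type (max u v) := TotalSpace V.F V.fiber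

/-- The involution of the total space. -/
def totalLift (V : EquivariantBundle.{u, v} f) (p : V.Total) : V.Total :=
  ⟨f.toFun p.proj, V.lift p.proj p.snd⟩

/-- An isomorphism of equivariant bundles: fibrewise linear isomorphisms over the identity of `X`
that are continuous in both directions on total spaces and commute with the involutions. -/
structure Iso (V W : EquivariantBundle.{u, v} f) where
  /-- the isomorphism on fibres -/
  equiv : ∀ x, V.fiber x ≃ₗ[ℂ] W.fiber x
  continuous_toFun : Continuous (fun p : V.Total => (⟨p.proj, equiv p.proj p.snd⟩ : W.Total))
  continuous_invFun :
    Continuous (fun p : W.Total => (⟨p.proj, (equiv p.proj).symm p.snd⟩ : V.Total))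
  map_lift : ∀ (x : X) (v : V.fiber x),
    equiv (f.toFun x) (V.lift x v) = W.lift x (equiv x v)

/-- The identity isomorphism. -/
def Iso.refl (V : EquivariantBundle.{u, v} f) : Iso V V where
  equiv x := LinearEquiv.refl ℂ (V.fiber x)
  continuous_toFun := continuous_id
  continuous_invFun := continuous_id
  map_lift _ _ := rfl

/-- The inverse isomorphism. -/
def Iso.symm {V W : EquivariantBundle.{u, v} f} (e : Iso V W) : Iso W V where
  equiv x := (e.equiv x).symm
  continuous_toFun := e.continuous_invFun
  continuous_invFun := e.continuous_toFun
  map_lift x w := by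
    rw [LinearEquiv.symm_apply_eq, e.map_lift, LinearEquiv.apply_symm_apply]

/-- The composition of isomorphisms. -/
def Iso.trans {V W U : EquivariantBundle.{u, v} f} (e : Iso V W) (e' : Iso W U) : Iso V U where
  equiv x := (e.equiv x).trans (e'.equiv x)
  continuous_toFun := e'.continuous_toFun.comp e.continuous_toFun
  continuous_invFun := e.continuous_invFun.comp e'.continuous_invFun
  map_lift x v := by
    simp [e.map_lift, e'.map_lift]

/-- The zero bundle. -/
def zero (f : ContinuousInvolution X) : EquivariantBundle.{u, v} f where
  F := PUnit.{v + 1}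
  fiber := Bundle.Trivial X PUnit.{v + 1}
  lift _ := 0
  continuous_lift := by
    rw [(Bundle.Trivial.isInducing_toProd X PUnit.{v + 1}).continuous_iff]
    exact (f.continuous_toFun.comp
      (FiberBundle.continuous_proj PUnit.{v + 1} (Bundle.Trivial X PUnit.{v + 1}))).prodMk
      continuous_const
  involutive_lift p := by
    obtain ⟨x, y⟩ := p
    exact congrArg (fun x => (⟨x, PUnit.unit⟩ :
      TotalSpace PUnit.{v + 1} (Bundle.Trivial X PUnit.{v + 1}))) (f.involutive x)

/-- A map into the total space of a fibrewise product is continuous when its two components are. -/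
theorem continuous_prod_mk {Y : Type*} [TopologicalSpace Y] (V W : EquivariantBundle.{u, v} f)
    {g : Y → TotalSpace (V.F × W.F) (fun x => V.fiber x × W.fiber x)}
    (h₁ : Continuous (fun y => (⟨(g y).proj, (g y).snd.1⟩ : V.Total)))
    (h₂ : Continuous (fun y => (⟨(g y).proj, (g y).snd.2⟩ : W.Total))) : Continuous g := by
  rw [(FiberBundle.Prod.isInducing_diag V.F V.fiber W.F W.fiber).continuous_iff]
  exact h₁.prodMk h₂

theorem continuous_prod_fst (V W : EquivariantBundle.{u, v} f) :
    Continuous (fun p : TotalSpace (V.F × W.F) (fun x => V.fiber x × W.fiber x) =>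
      (⟨p.proj, p.snd.1⟩ : V.Total)) :=
  continuous_fst.comp
    (FiberBundle.Prod.isInducing_diag V.F V.fiber W.F W.fiber).continuous

theorem continuous_prod_snd (V W : EquivariantBundle.{u, v} f) :
    Continuous (fun p : TotalSpace (V.F × W.F) (fun x => V.fiber x × W.fiber x) =>
      (⟨p.proj, p.snd.2⟩ : W.Total)) :=
  continuous_snd.comp
    (FiberBundle.Prod.isInducing_diag V.F V.fiber W.F W.fiber).continuous

/-- The direct (Whitney) sum of equivariant bundles, with the direct sum of the involutions. -/
def sum (V W : EquivariantBundle.{u, v} f) : EquivariantBundle.{u, v} f where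
  F := V.F × W.F
  fiber := fun x => V.fiber x × W.fiber x
  lift x := (V.lift x).prodMap (W.lift x)
  continuous_lift := continuous_prod_mk V W
    (V.continuous_lift.comp (continuous_prod_fst V W))
    (W.continuous_lift.comp (continuous_prod_snd V W))
  involutive_lift p := by
    apply (show Function.Injective
      (fun p : TotalSpace (V.F × W.F) (fun x => V.fiber x × W.fiber x) =>
        ((⟨p.proj, p.snd.1⟩ : V.Total), (⟨p.proj, p.snd.2⟩ : W.Total))) from ?_)
    · exact Prod.ext (V.involutive_lift ⟨p.proj, p.snd.1⟩) (W.involutive_lift ⟨p.proj, p.snd.2⟩)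
    · rintro ⟨x, a, b⟩ ⟨y, c, d⟩ h
      simp only [Prod.mk.injEq] at h
      obtain ⟨h₁, h₂⟩ := h
      cases h₁
      cases h₂
      rfl

/-- Direct sums of isomorphisms. -/
def Iso.sum {V V' W W' : EquivariantBundle.{u, v} f} (e : Iso V V') (e' : Iso W W') :
    Iso (V.sum W) (V'.sum W') where
  equiv x := LinearEquiv.prodCongr (e.equiv x) (e'.equiv x)
  continuous_toFun := continuous_prod_mk V' W'
    (e.continuous_toFun.comp (continuous_prod_fst V W))
    (e'.continuous_toFun.comp (continuous_prod_snd V W))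
  continuous_invFun := continuous_prod_mk V W
    (e.continuous_invFun.comp (continuous_prod_fst V' W'))
    (e'.continuous_invFun.comp (continuous_prod_snd V' W'))
  map_lift x v := Prod.ext (e.map_lift x v.1) (e'.map_lift x v.2)

/-- Commutativity of the direct sum. -/
def Iso.sumComm (V W : EquivariantBundle.{u, v} f) : Iso (V.sum W) (W.sum V) where
  equiv x := LinearEquiv.prodComm ℂ (V.fiber x) (W.fiber x)
  continuous_toFun := continuous_prod_mk W V (continuous_prod_snd V W) (continuous_prod_fst V W)
  continuous_invFun := continuous_prod_mk V W (continuous_prod_snd W V) (continuous_prod_fst W V)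
  map_lift _ _ := rfl

/-- Associativity of the direct sum. -/
def Iso.sumAssoc (V W U : EquivariantBundle.{u, v} f) :
    Iso ((V.sum W).sum U) (V.sum (W.sum U)) where
  equiv x := LinearEquiv.prodAssoc ℂ (V.fiber x) (W.fiber x) (U.fiber x)
  continuous_toFun := continuous_prod_mk V (W.sum U)
    ((continuous_prod_fst V W).comp (continuous_prod_fst (V.sum W) U))
    (continuous_prod_mk W U
      ((continuous_prod_snd V W).comp (continuous_prod_fst (V.sum W) U))
      (continuous_prod_snd (V.sum W) U))
  continuous_invFun := continuous_prod_mk (V.sum W) U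
    (continuous_prod_mk V W (continuous_prod_fst V (W.sum U))
      ((continuous_prod_fst W U).comp (continuous_prod_snd V (W.sum U))))
    ((continuous_prod_snd W U).comp (continuous_prod_snd V (W.sum U)))
  map_lift _ _ := rfl

/-- The zero bundle is neutral for the direct sum. -/
def Iso.sumZero (V : EquivariantBundle.{u, v} f) : Iso (V.sum (zero f)) V where
  equiv x :=
    { toFun := fun p => p.1
      invFun := fun a => (a, PUnit.unit)
      map_add' := fun _ _ => rfl
      map_smul' := fun _ _ => rfl
      left_inv := fun _ => rfl
      right_inv := fun _ => rfl }
  continuous_toFun := continuous_prod_fst V (zero f)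
  continuous_invFun := continuous_prod_mk V (zero f) continuous_id <| by
    exact (Bundle.Trivial.isInducing_toProd X PUnit.{v + 1}).continuous_iff.2
      ((FiberBundle.continuous_proj V.F V.fiber).prodMk continuous_const)
  map_lift _ _ := rfl

/-- The relation of being isomorphic as equivariant bundles. -/
instance setoid (f : ContinuousInvolution X) : Setoid (EquivariantBundle.{u, v} f) where
  r V W := Nonempty (Iso V W)
  iseqv :=
    { refl := fun V => ⟨Iso.refl V⟩
      symm := fun ⟨e⟩ => ⟨e.symm⟩
      trans := fun ⟨e⟩ ⟨e'⟩ => ⟨e.trans e'⟩ }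

end EquivariantBundle

/-- The set of isomorphism classes of `ℤ₂`-equivariant complex vector bundles over `(X, f)`. -/
def EquivariantVect (f : ContinuousInvolution X) : Type (max u (v + 1)) :=
  Quotient (EquivariantBundle.setoid.{u, v} f)

/-- The isomorphism class of an equivariant bundle. -/
def EquivariantBundle.isoClass {f : ContinuousInvolution X} (V : EquivariantBundle.{u, v} f) :
    EquivariantVect.{u, v} f :=
  Quotient.mk (EquivariantBundle.setoid.{u, v} f) V

/-- Isomorphism classes are added by direct sum. -/
instance EquivariantVect.instAdd (f : ContinuousInvolution X) : Add (EquivariantVect.{u, v} f) where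
  add := Quotient.map₂ EquivariantBundle.sum
    (fun _ _ ⟨e⟩ _ _ ⟨e'⟩ => ⟨EquivariantBundle.Iso.sum e e'⟩)

/-- The class of the zero bundle. -/
instance EquivariantVect.instZero (f : ContinuousInvolution X) :
    Zero (EquivariantVect.{u, v} f) where
  zero := (EquivariantBundle.zero f).isoClass

/-- Isomorphism classes form a commutative monoid under direct sum. -/
instance EquivariantVect.instAddCommMonoid (f : ContinuousInvolution X) :
    AddCommMonoid (EquivariantVect.{u, v} f) where
  add_assoc a b c := Quotient.inductionOn₃ a b c fun V W U =>
    Quotient.sound ⟨EquivariantBundle.Iso.sumAssoc V W U⟩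
  add_comm a b := Quotient.inductionOn₂ a b fun V W =>
    Quotient.sound ⟨EquivariantBundle.Iso.sumComm V W⟩
  zero_add a := Quotient.inductionOn a fun V =>
    Quotient.sound ⟨(EquivariantBundle.Iso.sumComm _ V).trans (EquivariantBundle.Iso.sumZero V)⟩
  add_zero a := Quotient.inductionOn a fun V =>
    Quotient.sound ⟨EquivariantBundle.Iso.sumZero V⟩
  nsmul := nsmulRec

/-- The equivariant K-group `K⁰_{ℤ₂}(X)` of a compact connected space `X` with involution `f`: the
Grothendieck group of the monoid of isomorphism classes of equivariant complex vector bundles.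
(Bundles here have one model fibre, which is automatic when `X` is connected.) -/
abbrev EquivariantK (f : ContinuousInvolution X) : Type (max u (v + 1)) :=
  Algebra.GrothendieckAddGroup (EquivariantVect.{u, v} f)

/-- The class `[V]` of an equivariant bundle in `K⁰_{ℤ₂}(X)`. -/
def EquivariantBundle.kClass {f : ContinuousInvolution X} (V : EquivariantBundle.{u, v} f) :
    EquivariantK.{u, v} f :=
  Algebra.GrothendieckAddGroup.of V.isoClass

end

/-! Equality in the Grothendieck group means `V ⊕ W ≅ V' ⊕ W` for some `W` (`kClass_eq_iff`), so the
content is cancellation. It is proved by induction on the rank in `nonempty_iso_of_iso_sum`.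

In rank one, cancellation is a determinant: an isomorphism `V ⊕ W → V' ⊕ W` induces `V ⊗ det W → V'
⊗ det W`, and removing `det W` leaves `V → V'`. `relDet` expresses this without exterior powers.

In rank at least two, a common line bundle `L` is split off from `V` and `V'`. The fibre at a fixed
point is a representation of `ℤ₂`, whose invariant part has a dimension determined by rank and
trace, hence the same for `V` and `V'`. Let `L` have sign `-1` over the fixed points where this
invariant part vanishes and sign `+1` over the others; then there are nonzero equivariant maps from
`L` to `V` over every fixed point. The fixed set of an antiholomorphic involution embeds locally
into a line, while these maps contain a complex line, of real dimension 2. Elsewhere the surface has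
real dimension 2, and `Hom(L, V)` has real dimension at least 4. Hence a generic equivariant
homomorphism vanishes nowhere (`exists_nonvanishing`, `exists_equivariantHom_ne_zero`) and embeds
`L` in `V`; averaging a left inverse gives an equivariant complement (`exists_iso_sum`). So `V ≅ L ⊕
V₁`, `V' ≅ L ⊕ V₁'`, and the induction hypothesis applies to `V₁`, `V₁'` and `L ⊕ W`.

The bundle `L` (`exists_lineBundle`) is the positive eigenline of a field of invertible traceless
hermitian `2 × 2` matrices, with `ℤ₂` acting through `diag(1, -1)`. Such matrices form `(ℂ × ℝ) ∖
0`, so the field exists by general position again, now because 2 < 3. -/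

noncomputable section

variable {X : Type u} [TopologicalSpace X]

/-! ### Fibrewise linear maps in local coordinates -/

namespace EquivariantBundle

variable {f : ContinuousInvolution X}

section Coordinates

variable (V W U : EquivariantBundle.{u, v} f)

/-- The domain of the preferred trivialization at `x₀`. -/
def base (x₀ : X) : Set X := (trivializationAt V.F V.fiber x₀).baseSet

/-- Fibre coordinates in the preferred trivialization at `x₀`. -/
def co (x₀ x : X) : V.fiber x →ₗ[ℂ] V.F :=
  (trivializationAt V.F V.fiber x₀).linearMapAt ℂ x

/-- The inverse of the fibre coordinates at `x₀`. -/
def frame (x₀ x : X) : V.F →ₗ[ℂ] V.fiber x :=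
  (trivializationAt V.F V.fiber x₀).symmₗ ℂ x

variable {V W U}

theorem isOpen_base (x₀ : X) : IsOpen (V.base x₀) := Trivialization.open_baseSet _

theorem mem_base (x₀ : X) : x₀ ∈ V.base x₀ :=
  FiberBundle.mem_baseSet_trivializationAt V.F V.fiber x₀

theorem base_mem_nhds {x₀ x : X} (h : x ∈ V.base x₀) : V.base x₀ ∈ 𝓝 x :=
  (isOpen_base x₀).mem_nhds h

theorem co_frame {x₀ x : X} (h : x ∈ V.base x₀) (y : V.F) : V.co x₀ x (V.frame x₀ x y) = y :=
  Trivialization.linearMapAt_symmₗ _ h y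

theorem frame_co {x₀ x : X} (h : x ∈ V.base x₀) (y : V.fiber x) :
    V.frame x₀ x (V.co x₀ x y) = y :=
  Trivialization.symmₗ_linearMapAt _ h y

theorem co_injective {x₀ x : X} (h : x ∈ V.base x₀) : Function.Injective (V.co x₀ x) :=
  Function.LeftInverse.injective (frame_co h)

theorem continuousAt_co {x₀ : X} {p : V.Total} (h : p.proj ∈ V.base x₀) :
    ContinuousAt (fun p : V.Total => V.co x₀ p.proj p.snd) p := by
  have h1 : ContinuousAt (fun p : V.Total => (trivializationAt V.F V.fiber x₀ p).2) p :=
    ((trivializationAt V.F V.fiber x₀).continuousAt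
      ((trivializationAt V.F V.fiber x₀).mem_source.2 h)).snd
  refine h1.congr ?_
  filter_upwards [(FiberBundle.continuous_proj V.F V.fiber).continuousAt (base_mem_nhds h)] with q hq
  exact (congrFun (Trivialization.coe_linearMapAt_of_mem
    (trivializationAt V.F V.fiber x₀) (R := ℂ) hq) q.snd).symm

theorem continuousAt_frame {x₀ : X} {q : X × V.F} (h : q.1 ∈ V.base x₀) :
    ContinuousAt (fun q : X × V.F => (⟨q.1, V.frame x₀ q.1 q.2⟩ : V.Total)) q := by
  set e := trivializationAt V.F V.fiber x₀
  have h1 : ContinuousAt (fun q : X × V.F => e.toOpenPartialHomeomorph.symm q) q :=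
    e.toOpenPartialHomeomorph.symm.continuousAt (e.mem_target.2 h)
  refine h1.congr ?_
  filter_upwards [continuous_fst.continuousAt (base_mem_nhds h)] with r hr
  rw [show V.frame x₀ r.1 = e.symmₗ ℂ r.1 from rfl, Trivialization.symmₗ_apply e hr]
  exact (e.mk_symm hr r.2).symm

variable (V W)

/-- Continuity on total spaces, over a point `x₀`, of a family of linear maps of the fibres. -/
def IsContHomAt (g : ∀ x, V.fiber x →ₗ[ℂ] W.fiber x) (x₀ : X) : Prop :=
  ∀ v, ContinuousAt (fun p : V.Total => (⟨p.proj, g p.proj p.snd⟩ : W.Total)) ⟨x₀, v⟩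

/-- Families of linear maps between the fibres that are continuous on total spaces. -/
def IsContHom (g : ∀ x, V.fiber x →ₗ[ℂ] W.fiber x) : Prop :=
  Continuous (fun p : V.Total => (⟨p.proj, g p.proj p.snd⟩ : W.Total))

/-- The matrix of a linear map between the fibres at `x` in the trivializations at `x₀`. -/
def coordAt (x₀ x : X) : (V.fiber x →ₗ[ℂ] W.fiber x) →ₗ[ℂ] (V.F →L[ℂ] W.F) where
  toFun g := LinearMap.toContinuousLinearMap (W.co x₀ x ∘ₗ g ∘ₗ V.frame x₀ x)
  map_add' g h := by ext; simp
  map_smul' c g := by ext; simp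

/-- The inverse operation to `coordAt`. -/
def uncoordAt (x₀ x : X) : (V.F →L[ℂ] W.F) →ₗ[ℂ] (V.fiber x →ₗ[ℂ] W.fiber x) where
  toFun m := W.frame x₀ x ∘ₗ (m : V.F →ₗ[ℂ] W.F) ∘ₗ V.co x₀ x
  map_add' g h := by ext; simp
  map_smul' c g := by ext; simp

variable {V W}

theorem coordAt_apply (x₀ x : X) (g : V.fiber x →ₗ[ℂ] W.fiber x) (y : V.F) :
    coordAt V W x₀ x g y = W.co x₀ x (g (V.frame x₀ x y)) := rfl

theorem uncoordAt_apply (x₀ x : X) (m : V.F →L[ℂ] W.F) (y : V.fiber x) :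
    uncoordAt V W x₀ x m y = W.frame x₀ x (m (V.co x₀ x y)) := rfl

theorem coordAt_uncoordAt {x₀ x : X} (hV : x ∈ V.base x₀) (hW : x ∈ W.base x₀)
    (m : V.F →L[ℂ] W.F) : coordAt V W x₀ x (uncoordAt V W x₀ x m) = m := by
  ext y
  rw [coordAt_apply, uncoordAt_apply, co_frame hV, co_frame hW]

theorem uncoordAt_coordAt {x₀ x : X} (hV : x ∈ V.base x₀) (hW : x ∈ W.base x₀)
    (g : V.fiber x →ₗ[ℂ] W.fiber x) : uncoordAt V W x₀ x (coordAt V W x₀ x g) = g := by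
  ext y
  rw [uncoordAt_apply, coordAt_apply, frame_co hV, frame_co hW]

theorem coordAt_injective {x₀ x : X} (hV : x ∈ V.base x₀) (hW : x ∈ W.base x₀) :
    Function.Injective (coordAt V W x₀ x) :=
  Function.LeftInverse.injective (uncoordAt_coordAt hV hW)

theorem coordAt_comp {x₀ x : X} (hW : x ∈ W.base x₀)
    (g : V.fiber x →ₗ[ℂ] W.fiber x) (g' : W.fiber x →ₗ[ℂ] U.fiber x) :
    coordAt V U x₀ x (g' ∘ₗ g) = coordAt W U x₀ x g' ∘L coordAt V W x₀ x g := by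
  ext y
  simp only [coordAt_apply, LinearMap.comp_apply, ContinuousLinearMap.comp_apply, frame_co hW]

/-- The model fibre is finite-dimensional, so norm continuity of the matrix is continuity on each
fixed vector. This turns continuity on total spaces into continuity of functions with values in a
fixed normed space. -/
theorem isContHomAt_iff {g : ∀ x, V.fiber x →ₗ[ℂ] W.fiber x} {x₀ x₁ : X}
    (hV : x₁ ∈ V.base x₀) (hW : x₁ ∈ W.base x₀) :
    IsContHomAt V W g x₁ ↔ ContinuousAt (fun x => coordAt V W x₀ x (g x)) x₁ := by
  constructor
  · intro hg
    refine continuousAt_clm_apply.2 fun y => ?_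
    have h1 : ContinuousAt (fun x : X => (⟨x, V.frame x₀ x y⟩ : V.Total)) x₁ :=
      ContinuousAt.comp (f := fun x : X => (x, y)) (x := x₁)
        (continuousAt_frame (q := (x₁, y)) hV) (by fun_prop)
    have h2 : ContinuousAt (fun x : X => (⟨x, g x (V.frame x₀ x y)⟩ : W.Total)) x₁ :=
      ContinuousAt.comp (f := fun x : X => (⟨x, V.frame x₀ x y⟩ : V.Total)) (x := x₁)
        (hg _) h1
    exact ContinuousAt.comp (f := fun x : X => (⟨x, g x (V.frame x₀ x y)⟩ : W.Total)) (x := x₁)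
      (continuousAt_co (x₀ := x₀) hW) h2
  · intro hg v
    have h1 : ContinuousAt (fun p : V.Total => V.co x₀ p.proj p.snd) ⟨x₁, v⟩ := continuousAt_co hV
    have hp : ContinuousAt (fun p : V.Total => p.proj) (⟨x₁, v⟩ : V.Total) :=
      (FiberBundle.continuous_proj V.F V.fiber).continuousAt
    have h2 : ContinuousAt (fun p : V.Total => coordAt V W x₀ p.proj (g p.proj)
        (V.co x₀ p.proj p.snd)) ⟨x₁, v⟩ :=
      (ContinuousAt.comp (f := fun p : V.Total => p.proj) (x := (⟨x₁, v⟩ : V.Total)) hg hp).clm_apply h1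
    have h3 := ContinuousAt.comp (f := fun p : V.Total => (p.proj, coordAt V W x₀ p.proj (g p.proj)
        (V.co x₀ p.proj p.snd))) (x := (⟨x₁, v⟩ : V.Total))
        (continuousAt_frame (V := W) (x₀ := x₀) hW) (hp.prodMk h2)
    refine h3.congr ?_
    filter_upwards [hp (base_mem_nhds hV), hp (base_mem_nhds hW)] with q hq hq'
    simp only [Function.comp, coordAt_apply]
    rw [frame_co (x := q.proj) hq, frame_co (x := q.proj) hq']

theorem isContHom_iff_forall {g : ∀ x, V.fiber x →ₗ[ℂ] W.fiber x} :
    IsContHom V W g ↔ ∀ x, IsContHomAt V W g x := by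
  rw [IsContHom, continuous_iff_continuousAt]
  exact ⟨fun h x v => h ⟨x, v⟩, fun h p => h p.1 p.2⟩

theorem IsContHom.continuousAt {g : ∀ x, V.fiber x →ₗ[ℂ] W.fiber x} (hg : IsContHom V W g)
    {x₀ x₁ : X} (hV : x₁ ∈ V.base x₀) (hW : x₁ ∈ W.base x₀) :
    ContinuousAt (fun x => coordAt V W x₀ x (g x)) x₁ :=
  (isContHomAt_iff hV hW).1 (isContHom_iff_forall.1 hg x₁)

theorem isContHom_of_coordAt {g : ∀ x, V.fiber x →ₗ[ℂ] W.fiber x}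
    (h : ∀ x₀, ContinuousAt (fun x => coordAt V W x₀ x (g x)) x₀) : IsContHom V W g :=
  isContHom_iff_forall.2 fun x => (isContHomAt_iff (mem_base x) (mem_base x)).2 (h x)

theorem IsContHomAt.congr {g g' : ∀ x, V.fiber x →ₗ[ℂ] W.fiber x} {x₀ : X}
    (hg : IsContHomAt V W g x₀) (h : ∀ᶠ x in 𝓝 x₀, g x = g' x) : IsContHomAt V W g' x₀ := by
  rw [isContHomAt_iff (mem_base x₀) (mem_base x₀)] at hg ⊢
  refine hg.congr ?_
  filter_upwards [h] with x hx
  rw [hx]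

theorem IsContHom.add {g g' : ∀ x, V.fiber x →ₗ[ℂ] W.fiber x} (hg : IsContHom V W g)
    (hg' : IsContHom V W g') : IsContHom V W (fun x => g x + g' x) :=
  isContHom_of_coordAt fun x₀ => by
    simp only [map_add]
    exact (hg.continuousAt (mem_base x₀) (mem_base x₀)).add
      (hg'.continuousAt (mem_base x₀) (mem_base x₀))

theorem IsContHom.smul {g : ∀ x, V.fiber x →ₗ[ℂ] W.fiber x} (hg : IsContHom V W g)
    {c : X → ℂ} (hc : Continuous c) : IsContHom V W (fun x => c x • g x) :=
  isContHom_of_coordAt fun x₀ => by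
    simp only [map_smul]
    exact hc.continuousAt.smul (hg.continuousAt (mem_base x₀) (mem_base x₀))

theorem isContHom_zero : IsContHom V W (fun _ => 0) :=
  isContHom_of_coordAt fun x₀ => by
    simp only [map_zero]
    exact continuousAt_const

theorem isContHom_id : IsContHom V V (fun _ => LinearMap.id) := continuous_id

theorem IsContHom.comp {g : ∀ x, V.fiber x →ₗ[ℂ] W.fiber x} {g' : ∀ x, W.fiber x →ₗ[ℂ] U.fiber x}
    (hg' : IsContHom W U g') (hg : IsContHom V W g) : IsContHom V U (fun x => g' x ∘ₗ g x) :=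
  Continuous.comp hg' hg

/-- A family of linear maps supported in a trivializing open set is continuous if its matrix is. -/
theorem isContHom_uncoordAt {x₀ : X} {m : X → (V.F →L[ℂ] W.F)} (hm : Continuous m)
    (h : tsupport m ⊆ V.base x₀ ∩ W.base x₀) :
    IsContHom V W (fun x => uncoordAt V W x₀ x (m x)) := by
  refine isContHom_iff_forall.2 fun x => ?_
  by_cases hx : x ∈ tsupport m
  · refine (isContHomAt_iff (h hx).1 (h hx).2).2 (hm.continuousAt.congr ?_)
    filter_upwards [base_mem_nhds (h hx).1, base_mem_nhds (h hx).2] with y hy hy'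
    rw [coordAt_uncoordAt hy hy']
  -- Off the support the family agrees locally with zero, so it does not matter what `uncoordAt`
  -- does outside the trivializing set.
  · refine (isContHom_iff_forall.1 isContHom_zero x).congr ?_
    filter_upwards [(isClosed_tsupport m).isOpen_compl.mem_nhds hx] with y hy
    rw [image_eq_zero_of_notMem_tsupport hy, map_zero]

end Coordinates

end EquivariantBundle

/-! ### Conjugation by the involution, inverses and traces -/

namespace EquivariantBundle

variable {f : ContinuousInvolution X}

section Equivariance

variable (V W U : EquivariantBundle.{u, v} f)

theorem totalLift_totalLift (p : V.Total) : V.totalLift (V.totalLift p) = p := V.involutive_lift p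

/-- The inverse is the lift at `f x`, but that lands in the fibre over `f (f x)`; arguing in the
total space avoids a transport between fibres. -/
theorem lift_bijective (x : X) : Function.Bijective (V.lift x) := by
  constructor
  · intro a b h
    have h1 : V.totalLift ⟨x, a⟩ = V.totalLift ⟨x, b⟩ :=
      congrArg (fun y => (⟨f.toFun x, y⟩ : V.Total)) h
    have h2 := congrArg V.totalLift h1
    rw [totalLift_totalLift, totalLift_totalLift] at h2
    exact TotalSpace.mk_injective x h2
  · intro w
    have h1 := V.totalLift_totalLift ⟨f.toFun x, w⟩
    obtain ⟨y, hy⟩ : ∃ q : V.Total, V.totalLift ⟨f.toFun x, w⟩ = q := ⟨_, rfl⟩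
    obtain ⟨y, a⟩ := y
    have hyx : y = x := by
      have := congrArg TotalSpace.proj hy
      exact this.symm.trans (f.involutive x)
    subst hyx
    rw [hy] at h1
    exact ⟨a, TotalSpace.mk_injective _ h1⟩

/-- The lift of the involution as a linear equivalence of fibres. -/
def liftEquiv (x : X) : V.fiber x ≃ₗ[ℂ] V.fiber (f.toFun x) :=
  LinearEquiv.ofBijective (V.lift x) (V.lift_bijective x)

theorem liftEquiv_apply (x : X) (v : V.fiber x) : V.liftEquiv x v = V.lift x v := rfl

/-- Compatibility of a family of linear maps with the involutions. -/
def IsEquivariant (g : ∀ x, V.fiber x →ₗ[ℂ] W.fiber x) : Prop :=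
  ∀ (x : X) (v : V.fiber x), g (f.toFun x) (V.lift x v) = W.lift x (g x v)

/-- Conjugation of a family of linear maps by the involutions. -/
def conj (g : ∀ x, V.fiber x →ₗ[ℂ] W.fiber x) (x : X) : V.fiber x →ₗ[ℂ] W.fiber x :=
  (W.liftEquiv x).symm.toLinearMap ∘ₗ g (f.toFun x) ∘ₗ V.lift x

variable {V W U}

theorem lift_conj (g : ∀ x, V.fiber x →ₗ[ℂ] W.fiber x) (x : X) (v : V.fiber x) :
    W.lift x (conj V W g x v) = g (f.toFun x) (V.lift x v) :=
  (W.liftEquiv x).apply_symm_apply _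

/-- On total spaces, conjugation is composition with the involution on both sides. Its continuity
and its involutivity can both be read off from this form. -/
theorem totalLift_comp_totalLift (g : ∀ x, V.fiber x →ₗ[ℂ] W.fiber x) (p : V.Total) :
    W.totalLift ⟨(V.totalLift p).proj, g _ (V.totalLift p).snd⟩ =
      ⟨p.proj, conj V W g p.proj p.snd⟩ := by
  have : (⟨(V.totalLift p).proj, g _ (V.totalLift p).snd⟩ : W.Total) =
      W.totalLift ⟨p.proj, conj V W g p.proj p.snd⟩ :=
    congrArg (fun y => (⟨f.toFun p.proj, y⟩ : W.Total)) (lift_conj g p.proj p.snd).symm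
  rw [this, totalLift_totalLift]

theorem IsContHom.conj {g : ∀ x, V.fiber x →ₗ[ℂ] W.fiber x} (hg : IsContHom V W g) :
    IsContHom V W (EquivariantBundle.conj V W g) := by
  have h : Continuous fun p : V.Total =>
      W.totalLift ⟨(V.totalLift p).proj, g _ (V.totalLift p).snd⟩ :=
    W.continuous_lift.comp (Continuous.comp hg V.continuous_lift)
  exact h.congr (totalLift_comp_totalLift g)

theorem conj_conj (g : ∀ x, V.fiber x →ₗ[ℂ] W.fiber x) : conj V W (conj V W g) = g := by
  funext x
  ext v
  have h := totalLift_comp_totalLift (conj V W g) ⟨x, v⟩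
  rw [← totalLift_comp_totalLift g] at h
  rw [totalLift_totalLift, totalLift_totalLift] at h
  exact (TotalSpace.mk_injective x h).symm

theorem isEquivariant_iff_conj {g : ∀ x, V.fiber x →ₗ[ℂ] W.fiber x} :
    IsEquivariant V W g ↔ conj V W g = g := by
  constructor
  · intro h
    funext x
    ext v
    exact (W.lift_bijective x).1 (by rw [lift_conj, h])
  · intro h x v
    rw [← lift_conj, h]

theorem conj_add (g g' : ∀ x, V.fiber x →ₗ[ℂ] W.fiber x) :
    conj V W (fun x => g x + g' x) = fun x => conj V W g x + conj V W g' x := by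
  funext x
  ext v
  simp [conj]

theorem conj_comp (g : ∀ x, V.fiber x →ₗ[ℂ] W.fiber x) (g' : ∀ x, W.fiber x →ₗ[ℂ] U.fiber x) :
    conj V U (fun x => g' x ∘ₗ g x) = fun x => conj W U g' x ∘ₗ conj V W g x := by
  funext x
  ext v
  apply (U.lift_bijective x).1
  simp only [lift_conj, LinearMap.comp_apply]

theorem isEquivariant_add_conj (g : ∀ x, V.fiber x →ₗ[ℂ] W.fiber x) :
    IsEquivariant V W (fun x => g x + conj V W g x) := by
  rw [isEquivariant_iff_conj, conj_add, conj_conj]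
  funext x
  exact add_comm _ _

theorem IsEquivariant.add {g g' : ∀ x, V.fiber x →ₗ[ℂ] W.fiber x} (hg : IsEquivariant V W g)
    (hg' : IsEquivariant V W g') : IsEquivariant V W (fun x => g x + g' x) := fun x v => by
  simp [hg x v, hg' x v]

theorem IsEquivariant.comp {g : ∀ x, V.fiber x →ₗ[ℂ] W.fiber x}
    {g' : ∀ x, W.fiber x →ₗ[ℂ] U.fiber x} (hg' : IsEquivariant W U g') (hg : IsEquivariant V W g) :
    IsEquivariant V U (fun x => g' x ∘ₗ g x) := fun x v => by
  simp [hg x v, hg' x _]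

theorem IsEquivariant.smul {g : ∀ x, V.fiber x →ₗ[ℂ] W.fiber x} (hg : IsEquivariant V W g)
    {c : X → ℂ} (hc : ∀ x, c (f.toFun x) = c x) : IsEquivariant V W (fun x => c x • g x) :=
  fun x v => by simp [hg x v, hc x]

theorem isEquivariant_id : IsEquivariant V V (fun _ => LinearMap.id) := fun _ _ => rfl

/-- The inverse of a continuous family of linear equivalences is continuous. -/
theorem IsContHom.symm {g : ∀ x, V.fiber x ≃ₗ[ℂ] W.fiber x}
    (hg : IsContHom V W (fun x => (g x).toLinearMap)) :
    IsContHom W V (fun x => (g x).symm.toLinearMap) := by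
  refine isContHom_of_coordAt fun x₀ => ?_
  have : CompleteSpace V.F := FiniteDimensional.complete ℂ V.F
  have key : ∀ x ∈ V.base x₀ ∩ W.base x₀, ∃ e : V.F ≃L[ℂ] W.F,
      (e : V.F →L[ℂ] W.F) = coordAt V W x₀ x (g x).toLinearMap ∧
      (e.symm : W.F →L[ℂ] V.F) = coordAt W V x₀ x (g x).symm.toLinearMap := by
    rintro x ⟨hV, hW⟩
    refine ⟨ContinuousLinearEquiv.equivOfInverse (coordAt V W x₀ x (g x).toLinearMap)
      (coordAt W V x₀ x (g x).symm.toLinearMap) ?_ ?_, ?_, ?_⟩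
    · intro y
      simp [coordAt_apply, frame_co hW, co_frame hV]
    · intro y
      simp [coordAt_apply, frame_co hV, co_frame hW]
    · ext y; rfl
    · ext y; rfl
  have hev : ∀ᶠ x in 𝓝 x₀, x ∈ V.base x₀ ∩ W.base x₀ :=
    ((isOpen_base x₀).inter (isOpen_base x₀)).mem_nhds ⟨mem_base x₀, mem_base x₀⟩
  obtain ⟨e, he, -⟩ := key x₀ ⟨mem_base x₀, mem_base x₀⟩
  -- In coordinates, passing to the inverse family is operator inversion, which is continuous at
  -- invertible operators.
  have h1 : ContinuousAt ContinuousLinearMap.inverse (coordAt V W x₀ x₀ (g x₀).toLinearMap) :=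
    he ▸ (contDiffAt_map_inverse (𝕜 := ℂ) (n := 0) e).continuousAt
  refine (ContinuousAt.comp (f := fun x => coordAt V W x₀ x (g x).toLinearMap) (x := x₀) h1
    (hg.continuousAt (mem_base x₀) (mem_base x₀))).congr ?_
  filter_upwards [hev] with x hx
  obtain ⟨e, he, he'⟩ := key x hx
  rw [Function.comp, ← he, ← he', ContinuousLinearMap.inverse_equiv]

/-- A continuous equivariant family of bijective linear maps is an isomorphism. -/
theorem nonempty_iso_of_bijective {g : ∀ x, V.fiber x →ₗ[ℂ] W.fiber x} (hg : IsContHom V W g)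
    (he : IsEquivariant V W g) (hb : ∀ x, Function.Bijective (g x)) : Nonempty (Iso V W) :=
  ⟨{ equiv := fun x => LinearEquiv.ofBijective (g x) (hb x)
     continuous_toFun := hg
     continuous_invFun := IsContHom.symm (g := fun x => LinearEquiv.ofBijective (g x) (hb x)) hg
     map_lift := he }⟩

theorem finiteDimensional_fiber (V : EquivariantBundle.{u, v} f) (x : X) :
    FiniteDimensional ℂ (V.fiber x) :=
  FiniteDimensional.of_injective (V.co x x) (co_injective (mem_base x))

/-- The fibre is linearly equivalent to the model fibre. -/
def coEquiv (V : EquivariantBundle.{u, v} f) {x₀ x : X} (h : x ∈ V.base x₀) :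
    V.fiber x ≃ₗ[ℂ] V.F :=
  LinearEquiv.ofLinearMap (V.co x₀ x) (V.frame x₀ x) (LinearMap.ext (co_frame h))
    (LinearMap.ext (frame_co h))

theorem finrank_fiber (V : EquivariantBundle.{u, v} f) (x : X) :
    Module.finrank ℂ (V.fiber x) = Module.finrank ℂ V.F :=
  (V.coEquiv (mem_base x)).finrank_eq

attribute [instance] finiteDimensional_fiber

/-- The trace of a continuous family of endomorphisms is continuous. -/
theorem IsContHom.continuous_trace {g : ∀ x, V.fiber x →ₗ[ℂ] V.fiber x} (hg : IsContHom V V g) :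
    Continuous fun x => LinearMap.trace ℂ (V.fiber x) (g x) := by
  refine continuous_iff_continuousAt.2 fun x₀ => ?_
  let t : (V.F →L[ℂ] V.F) →ₗ[ℂ] ℂ := LinearMap.trace ℂ V.F ∘ₗ ContinuousLinearMap.coeLM ℂ
  have ht : Continuous t := t.continuous_of_finiteDimensional
  refine (ContinuousAt.comp (f := fun x => coordAt V V x₀ x (g x)) (x := x₀) ht.continuousAt
    (hg.continuousAt (mem_base x₀) (mem_base x₀))).congr ?_
  filter_upwards [base_mem_nhds (mem_base (V := V) x₀)] with x hx
  exact LinearMap.trace_conj' (g x) (V.coEquiv hx)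

/-- The lift at `x` carries `conj g` at `x` to `g` at `f x`, and traces are invariant under change
of basis. -/
theorem trace_conj_eq (g : ∀ x, V.fiber x →ₗ[ℂ] V.fiber x) (x : X) :
    LinearMap.trace ℂ _ (conj V V g x) = LinearMap.trace ℂ _ (g (f.toFun x)) := by
  rw [← LinearMap.trace_conj' (conj V V g x) (V.liftEquiv x)]
  congr 1
  ext v
  obtain ⟨w, rfl⟩ := (V.liftEquiv x).surjective v
  simp only [LinearEquiv.conj_apply, LinearMap.comp_apply, LinearEquiv.coe_coe, liftEquiv_apply,
    lift_conj]
  exact congrArg (fun z => g _ (V.lift x z)) ((V.liftEquiv x).symm_apply_apply w)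

end Equivariance

end EquivariantBundle

/-! ### The range of an equivariant projection as a bundle -/

namespace EquivariantBundle

variable {f : ContinuousInvolution X}

/-- A continuous equivariant family of idempotents of constant rank. -/
structure Projection (V : EquivariantBundle.{u, v} f) (d : ℕ) where
  /-- the idempotent in each fibre -/
  map : ∀ x, V.fiber x →ₗ[ℂ] V.fiber x
  idem : ∀ x v, map x (map x v) = map x v
  isContHom : IsContHom V V map
  isEquivariant : IsEquivariant V V map
  finrank_range : ∀ x, Module.finrank ℂ (LinearMap.range (map x)) = d

namespace Projection

variable {V : EquivariantBundle.{u, v} f} {d : ℕ} (P : V.Projection d)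

/-- The model fibre of the range of a projection of rank `d`. -/
abbrev Model (d : ℕ) : Type v := ULift.{v} (Fin d) → ℂ

/-- The fibres of the range of a projection. -/
abbrev Fiber (x : X) : Type v := LinearMap.range (P.map x)

theorem map_coe {x : X} (v : P.Fiber x) : P.map x v = v := by
  obtain ⟨_, w, rfl⟩ := v
  exact P.idem x w

/-- The inclusion of the range of a projection into the ambient bundle. -/
def incl (p : TotalSpace (Model.{v} d) P.Fiber) : V.Total := ⟨p.proj, p.snd⟩

instance : TopologicalSpace (TotalSpace (Model.{v} d) P.Fiber) :=
  TopologicalSpace.induced P.incl inferInstance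

theorem isInducing_incl : IsInducing P.incl := ⟨rfl⟩

theorem incl_injective : Function.Injective P.incl := by
  rintro ⟨x, a⟩ ⟨y, b⟩ h
  obtain rfl : x = y := congrArg TotalSpace.proj h
  exact congrArg (TotalSpace.mk x) (Subtype.ext (TotalSpace.mk_injective x h))

theorem continuous_proj : Continuous (fun p : TotalSpace (Model.{v} d) P.Fiber => p.proj) :=
  (FiberBundle.continuous_proj V.F V.fiber).comp P.isInducing_incl.continuous

theorem nonempty_modelEquiv (x : X) : Nonempty (Model.{v} d ≃ₗ[ℂ] P.Fiber x) := by
  refine FiniteDimensional.nonempty_linearEquiv_of_finrank_eq ?_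
  rw [P.finrank_range, Module.finrank_fintype_fun_eq_card, Fintype.card_ulift, Fintype.card_fin]

/-- An identification of the model fibre with the range at `x`. -/
def modelEquiv (x : X) : Model.{v} d ≃ₗ[ℂ] P.Fiber x := (P.nonempty_modelEquiv x).some

/-- Local frames for the range near `x₀`. -/
def fromModel (x₀ x : X) : Model.{v} d →ₗ[ℂ] P.Fiber x :=
  (P.map x).rangeRestrict ∘ₗ V.frame x₀ x ∘ₗ V.co x₀ x₀ ∘ₗ (LinearMap.range (P.map x₀)).subtype ∘ₗ
    (P.modelEquiv x₀).toLinearMap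

/-- Local coordinates for the range near `x₀`. -/
def toModel (x₀ x : X) : V.fiber x →ₗ[ℂ] Model.{v} d :=
  (P.modelEquiv x₀).symm.toLinearMap ∘ₗ (P.map x₀).rangeRestrict ∘ₗ V.frame x₀ x₀ ∘ₗ V.co x₀ x

/-- The comparison of local frames and local coordinates. -/
def change (x₀ x : X) : Model.{v} d →L[ℂ] Model.{v} d :=
  LinearMap.toContinuousLinearMap
    (P.toModel x₀ x ∘ₗ (LinearMap.range (P.map x)).subtype ∘ₗ P.fromModel x₀ x)

theorem continuousAt_fromModel {x₀ : X} {q : X × Model.{v} d} (hq : q.1 ∈ V.base x₀) :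
    ContinuousAt (fun q : X × Model.{v} d =>
      (⟨q.1, P.fromModel x₀ q.1 q.2⟩ : TotalSpace (Model.{v} d) P.Fiber)) q := by
  rw [P.isInducing_incl.continuousAt_iff]
  let a : Model.{v} d →ₗ[ℂ] V.F := V.co x₀ x₀ ∘ₗ (LinearMap.range (P.map x₀)).subtype ∘ₗ
    (P.modelEquiv x₀).toLinearMap
  have ha : Continuous a := a.continuous_of_finiteDimensional
  have h1 : ContinuousAt (fun q : X × Model.{v} d => (⟨q.1, V.frame x₀ q.1 (a q.2)⟩ : V.Total)) q :=
    ContinuousAt.comp (f := fun q : X × Model.{v} d => (q.1, a q.2)) (x := q)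
      (continuousAt_frame (V := V) (q := (q.1, a q.2)) hq)
      (continuous_fst.prodMk (ha.comp continuous_snd)).continuousAt
  exact ContinuousAt.comp
    (f := fun q : X × Model.{v} d => (⟨q.1, V.frame x₀ q.1 (a q.2)⟩ : V.Total)) (x := q)
    (Continuous.continuousAt P.isContHom) h1

theorem continuousAt_toModel {x₀ : X} {p : V.Total} (hp : p.proj ∈ V.base x₀) :
    ContinuousAt (fun p : V.Total => P.toModel x₀ p.proj p.snd) p := by
  let a : V.F →ₗ[ℂ] Model.{v} d := (P.modelEquiv x₀).symm.toLinearMap ∘ₗ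
    (P.map x₀).rangeRestrict ∘ₗ V.frame x₀ x₀
  exact ContinuousAt.comp (f := fun p : V.Total => V.co x₀ p.proj p.snd) (x := p)
    a.continuous_of_finiteDimensional.continuousAt (continuousAt_co hp)

theorem continuousAt_change {x₀ x : X} (hx : x ∈ V.base x₀) :
    ContinuousAt (P.change x₀) x := by
  refine continuousAt_clm_apply.2 fun y => ?_
  have h1 : ContinuousAt (fun x : X => P.incl ⟨x, P.fromModel x₀ x y⟩) x :=
    ContinuousAt.comp (f := fun x : X =>
        (⟨x, P.fromModel x₀ x y⟩ : TotalSpace (Model.{v} d) P.Fiber)) (x := x)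
      P.isInducing_incl.continuous.continuousAt
      (ContinuousAt.comp (f := fun x : X => (x, y)) (x := x)
        (P.continuousAt_fromModel (q := (x, y)) hx) (by fun_prop))
  exact ContinuousAt.comp (f := fun x : X => P.incl ⟨x, P.fromModel x₀ x y⟩) (x := x)
    (P.continuousAt_toModel (x₀ := x₀) hx) h1

/-- The domain of the local trivialization of the range at `x₀`. -/
def domain (x₀ : X) : Set X := {x | x ∈ V.base x₀ ∧ IsUnit (P.change x₀ x)}

theorem isOpen_domain (x₀ : X) : IsOpen (P.domain x₀) := by
  refine isOpen_iff_mem_nhds.2 fun x hx => ?_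
  filter_upwards [base_mem_nhds hx.1,
    (P.continuousAt_change hx.1) (Units.isOpen.mem_nhds hx.2)] with y h1 h2
  exact ⟨h1, h2⟩

/-- Local frames and coordinates are mutually inverse at the centre itself; by openness of the units
they therefore remain comparable nearby. -/
theorem change_self (x₀ : X) : P.change x₀ x₀ = 1 := by
  ext y
  have h (z : P.Fiber x₀) : V.frame x₀ x₀ (V.co x₀ x₀ (z : V.fiber x₀)) = z :=
    frame_co (mem_base x₀) _
  have h' (z : P.Fiber x₀) : (P.map x₀).rangeRestrict z = z := Subtype.ext (P.map_coe z)
  simp only [change, toModel, fromModel, LinearMap.coe_toContinuousLinearMap', LinearMap.comp_apply,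
    Submodule.subtype_apply, LinearEquiv.coe_coe, h, h', LinearEquiv.symm_apply_apply,
    one_apply_eq_self]

theorem mem_domain (x₀ : X) : x₀ ∈ P.domain x₀ :=
  ⟨mem_base x₀, by rw [change_self]; exact isUnit_one⟩

theorem change_apply (x₀ x : X) (y : Model.{v} d) :
    P.change x₀ x y = P.toModel x₀ x (P.fromModel x₀ x y) := rfl

theorem inverse_change {x₀ x : X} (hx : x ∈ P.domain x₀) (y : Model.{v} d) :
    Ring.inverse (P.change x₀ x) (P.change x₀ x y) = y := by
  rw [← mul_apply_eq_comp, Ring.inverse_mul_cancel _ hx.2,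
    one_apply_eq_self]

theorem change_inverse {x₀ x : X} (hx : x ∈ P.domain x₀) (y : Model.{v} d) :
    P.change x₀ x (Ring.inverse (P.change x₀ x) y) = y := by
  rw [← mul_apply_eq_comp, Ring.mul_inverse_cancel _ hx.2,
    one_apply_eq_self]

/-- Invertibility of `change` makes the frame injective, and the constant rank makes source and
target equidimensional. -/
theorem fromModel_surjective {x₀ x : X} (hx : x ∈ P.domain x₀) :
    Function.Surjective (P.fromModel x₀ x) := by
  have hinj : Function.Injective (P.fromModel x₀ x) := fun a b h => by
    rw [← P.inverse_change hx a, ← P.inverse_change hx b, change_apply, change_apply, h]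
  exact (LinearMap.injective_iff_surjective_of_finrank_eq_finrank
    (P.modelEquiv x).finrank_eq).1 hinj

/-- The local trivialization of the range at `x₀`. -/
def triv (x₀ : X) : Trivialization (Model.{v} d) (π (Model.{v} d) P.Fiber) where
  toFun p := (p.proj, P.toModel x₀ p.proj p.snd)
  -- Away from `x₀` the frame is not inverse to the coordinates; the discrepancy is `change`, which
  -- is inverted here.
  invFun q := ⟨q.1, P.fromModel x₀ q.1 (Ring.inverse (P.change x₀ q.1) q.2)⟩
  source := (fun p => p.proj) ⁻¹' P.domain x₀
  target := P.domain x₀ ×ˢ Set.univ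
  map_source' p hp := ⟨hp, trivial⟩
  map_target' q hq := hq.1
  left_inv' := by
    rintro ⟨x, w⟩ hx
    obtain ⟨y, hy⟩ := P.fromModel_surjective (x := x) hx w
    subst hy
    exact congrArg (fun z => (⟨x, P.fromModel x₀ x z⟩ : TotalSpace (Model.{v} d) P.Fiber))
      (P.inverse_change hx y)
  right_inv' := by
    rintro ⟨x, y⟩ hx
    exact congrArg (Prod.mk x) (P.change_inverse hx.1 y)
  open_source := (P.isOpen_domain x₀).preimage P.continuous_proj
  open_target := (P.isOpen_domain x₀).prod isOpen_univ
  continuousOn_toFun p hp := by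
    refine ContinuousAt.continuousWithinAt ?_
    exact P.continuous_proj.continuousAt.prodMk
      (ContinuousAt.comp (f := P.incl) (x := p) (P.continuousAt_toModel (x₀ := x₀) hp.1)
        P.isInducing_incl.continuous.continuousAt)
  continuousOn_invFun q hq := by
    refine ContinuousAt.continuousWithinAt ?_
    have h1 : ContinuousAt (fun q : X × Model.{v} d => Ring.inverse (P.change x₀ q.1)) q := by
      obtain ⟨a, ha⟩ := hq.1.2
      refine ContinuousAt.comp (f := fun q : X × Model.{v} d => P.change x₀ q.1) (x := q)
        (g := Ring.inverse) ?_ ?_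
      · rw [← ha]
        exact NormedRing.inverse_continuousAt a
      · exact ContinuousAt.comp (f := fun q : X × Model.{v} d => q.1) (x := q)
          (P.continuousAt_change hq.1.1) continuousAt_fst
    exact ContinuousAt.comp
      (f := fun q : X × Model.{v} d => (q.1, Ring.inverse (P.change x₀ q.1) q.2)) (x := q)
      (P.continuousAt_fromModel (x₀ := x₀) hq.1.1)
      (continuousAt_fst.prodMk (h1.clm_apply continuousAt_snd))
  baseSet := P.domain x₀
  open_baseSet := P.isOpen_domain x₀
  source_eq := rfl
  target_eq := rfl
  proj_toFun _ _ := rfl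

instance : FiberBundle (Model.{v} d) P.Fiber where
  totalSpaceMk_isInducing' x := by
    refine (IsInducing.of_comp_iff P.isInducing_incl).1 ?_
    exact (FiberBundle.totalSpaceMk_isInducing V.F V.fiber x).comp IsInducing.subtypeVal
  trivializationAtlas' := Set.range P.triv
  trivializationAt' := P.triv
  mem_baseSet_trivializationAt' := P.mem_domain
  trivialization_mem_atlas' x := ⟨x, rfl⟩

theorem isLinear_triv (x₀ : X) : (P.triv x₀).IsLinear ℂ :=
  ⟨fun x _ => (P.toModel x₀ x ∘ₗ (LinearMap.range (P.map x)).subtype).isLinear⟩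

instance : VectorBundle ℂ (Model.{v} d) P.Fiber where
  trivialization_linear' := by
    rintro _ ⟨⟨x₀, rfl⟩⟩
    exact P.isLinear_triv x₀
  continuousOn_coordChange' := by
    rintro e e' ⟨⟨x₀, rfl⟩⟩ ⟨⟨x₁, rfl⟩⟩
    have := P.isLinear_triv x₀
    have := P.isLinear_triv x₁
    refine continuousOn_clm_apply.2 fun y => ?_
    change ContinuousOn (fun x => (P.triv x₀).coordChangeL ℂ (P.triv x₁) x y) _
    have h : ContinuousOn (fun x => (P.triv x₁
        ((P.triv x₀).toOpenPartialHomeomorph.symm (x, y))).2)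
        ((P.triv x₀).baseSet ∩ (P.triv x₁).baseSet) := by
      refine ContinuousOn.snd ((P.triv x₁).continuousOn.comp
        ((P.triv x₀).toOpenPartialHomeomorph.continuousOn_symm.comp (by fun_prop) ?_) ?_)
      · exact fun x hx => ⟨hx.1, trivial⟩
      · exact fun x hx => hx.2
    refine h.congr fun x hx => ?_
    exact (congrArg Prod.snd
      (Trivialization.apply_symm_apply_eq_coordChangeL (R := ℂ) _ _ hx y)).symm

/-- The range of a projection, as an equivariant bundle. -/
def bundle : EquivariantBundle.{u, v} f where
  F := Model.{v} d
  fiber := P.Fiber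
  lift x := (V.lift x).restrict (p := LinearMap.range (P.map x))
    (q := LinearMap.range (P.map (f.toFun x))) (by
      rintro _ ⟨w, rfl⟩
      exact ⟨V.lift x w, P.isEquivariant x w⟩)
  continuous_lift := P.isInducing_incl.continuous_iff.2
    (V.continuous_lift.comp P.isInducing_incl.continuous)
  involutive_lift p := P.incl_injective (V.involutive_lift (P.incl p))

theorem finrank_bundle : Module.finrank ℂ P.bundle.F = d := by
  change Module.finrank ℂ (Model.{v} d) = d
  rw [Module.finrank_fintype_fun_eq_card, Fintype.card_ulift, Fintype.card_fin]

/-- Families of linear maps into the range of a projection. -/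
theorem isContHom_codRestrict {W : EquivariantBundle.{u, v} f}
    {g : ∀ x, W.fiber x →ₗ[ℂ] V.fiber x} (hg : IsContHom W V g)
    (h : ∀ x w, g x w ∈ LinearMap.range (P.map x)) :
    IsContHom W P.bundle (fun x => (g x).codRestrict (LinearMap.range (P.map x)) (h x)) :=
  P.isInducing_incl.continuous_iff.2 hg

end Projection

end EquivariantBundle

/-! ### General position -/

/-- On a compact space that embeds into a normed space of dimension `< dim F`, continuous functions
with values in `F` can be approximated by nowhere vanishing ones. -/
theorem exists_nonvanishing_approx {K : Type*} [TopologicalSpace K] [CompactSpace K]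
    {G F : Type*} [NormedAddCommGroup G] [NormedSpace ℝ G] [FiniteDimensional ℝ G]
    [NormedAddCommGroup F] [NormedSpace ℝ F] [FiniteDimensional ℝ F]
    (hGF : Module.finrank ℝ G < Module.finrank ℝ F) (ι : C(K, G)) (hι : Function.Injective ι)
    (g : C(K, F)) {ε : ℝ} (hε : 0 < ε) :
    ∃ g' : C(K, F), (∀ x, g' x ≠ 0) ∧ ∀ x, ‖g' x - g x‖ < ε := by
  have hemb : IsClosedEmbedding ι := ι.continuous.isClosedEmbedding hι
  have : TietzeExtension F := RCLike.instTietzeExtensionTVS (𝕜 := ℝ)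
  obtain ⟨g₁, hg₁⟩ := ContinuousMap.exists_extension' hemb g
  -- A `C¹` map into a space of larger dimension has an image with dense complement. So a smooth
  -- approximation misses arbitrarily small values `c`, and subtracting one of them removes all
  -- zeros.
  obtain ⟨p, hp, hpg, -⟩ := g₁.continuous.exists_contDiff_approx 1 (ε := fun _ => ε / 2)
    continuous_const (fun _ => half_pos hε)
  obtain ⟨c, hc, hcε⟩ := (hp.dense_compl_range_of_finrank_lt_finrank hGF).exists_dist_lt 0
    (half_pos hε)
  refine ⟨⟨fun x => p (ι x) - c, by have := hp.continuous; fun_prop⟩, fun x hx => ?_, fun x => ?_⟩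
  · exact hc ⟨ι x, sub_eq_zero.1 hx⟩
  · have h1 := hpg (ι x)
    rw [show g₁ (ι x) = g x from congrFun hg₁ x, dist_eq_norm] at h1
    rw [dist_eq_norm, zero_sub, norm_neg] at hcε
    calc ‖p (ι x) - c - g x‖ = ‖(p (ι x) - g x) - c‖ := by congr 1; abel
      _ ≤ ‖p (ι x) - g x‖ + ‖c‖ := norm_sub_le _ _
      _ < ε := by linarith

/-- A function on a compact set on which the involution acts freely or trivially extends to an
invariant function. -/
theorem exists_invariant_extension [T2Space X] [CompactSpace X] (f : ContinuousInvolution X)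
    {F : Type*} [NormedAddCommGroup F] [NormedSpace ℝ F] [FiniteDimensional ℝ F]
    {A : Set X} (hA : IsClosed A) (hfix : ∀ y ∈ A, f.toFun y ∈ A → f.toFun y = y)
    (g : C(A, F)) {ε : ℝ} (hε : 0 < ε) (hg : ∀ x, ‖g x‖ ≤ ε) :
    ∃ h : C(X, F), (∀ x, h (f.toFun x) = h x) ∧ (∀ x, ‖h x‖ ≤ ε) ∧ ∀ x : A, h x = g x := by
  classical
  let A' : Set X := f.toFun ⁻¹' A
  have hA' : IsClosed A' := hA.preimage f.continuous_toFun
  -- The invariant extension of `g` to `A ∪ f⁻¹(A)`. The two clauses agree on the overlap because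
  -- points there are fixed.
  let H : X → F := fun y => if hy : y ∈ A then g ⟨y, hy⟩ else
    if hy : f.toFun y ∈ A then g ⟨f.toFun y, hy⟩ else 0
  have H1 : ∀ y (hy : y ∈ A), H y = g ⟨y, hy⟩ := fun y hy => by simp [H, hy]
  have H2 : ∀ y (hy : f.toFun y ∈ A), H y = g ⟨f.toFun y, hy⟩ := fun y hy => by
    by_cases h : y ∈ A
    · rw [H1 y h]
      congr 2
      exact (hfix y h hy).symm
    · simp [H, hy, h]
  have hc1 : ContinuousOn H A := by
    rw [continuousOn_iff_continuous_domRestrict]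
    exact g.continuous.congr fun y => (H1 y y.2).symm
  have hc2 : ContinuousOn H A' := by
    rw [continuousOn_iff_continuous_domRestrict]
    have : Continuous fun y : A' => g ⟨f.toFun y, y.2⟩ :=
      g.continuous.comp (Continuous.subtype_mk (f.continuous_toFun.comp continuous_subtype_val) _)
    exact this.congr fun y => (H2 y y.2).symm
  have hc : ContinuousOn H (A ∪ A') := hc1.union_of_isClosed hc2 hA hA'
  have hb : ∀ y : ↥(A ∪ A'), H y ∈ Metric.closedBall (0 : F) ε := by
    rintro ⟨y, hy | hy⟩
    · rw [H1 y hy]; simpa using hg _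
    · rw [H2 y hy]; simpa using hg _
  have : TietzeExtension (Metric.closedBall (0 : F) ε) :=
    Metric.instTietzeExtensionClosedBall ℝ 0 hε
  obtain ⟨h, hh, hr⟩ := ContinuousMap.exists_forall_mem_restrict_eq (hA.union hA')
    ⟨_, continuousOn_iff_continuous_domRestrict.1 hc⟩ hb
  have hr' : ∀ y ∈ A ∪ A', h y = H y := fun y hy => congrArg (fun k => k ⟨y, hy⟩) hr
  have hf := f.continuous_toFun
  -- Averaging makes the Tietze extension invariant. It keeps the bound, and it keeps the values on
  -- `A` since `H` is already invariant there.
  refine ⟨⟨fun x => (2⁻¹ : ℝ) • (h x + h (f.toFun x)), by fun_prop⟩, fun x => ?_, fun x => ?_, ?_⟩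
  · simp only [ContinuousMap.coe_mk]
    rw [f.involutive x, add_comm]
  · have h1 := hh x
    have h2 := hh (f.toFun x)
    rw [mem_closedBall_zero_iff] at h1 h2
    calc ‖(2⁻¹ : ℝ) • (h x + h (f.toFun x))‖ = 2⁻¹ * ‖h x + h (f.toFun x)‖ := by
          rw [norm_smul]; norm_num
      _ ≤ 2⁻¹ * (ε + ε) := by gcongr; exact norm_add_le_of_le h1 h2
      _ = ε := by ring
  · rintro ⟨y, hy⟩
    have hfy : f.toFun y ∈ A' := by
      change f.toFun (f.toFun y) ∈ A
      rwa [f.involutive y]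
    have e1 : H (f.toFun y) = g ⟨y, hy⟩ := by
      rw [H2 _ hfy]
      congr 2
      exact f.involutive y
    simp only [ContinuousMap.coe_mk]
    rw [hr' y (Or.inl hy), hr' _ (Or.inr hfy), H1 y hy, e1, ← two_smul ℝ, smul_smul]
    norm_num

/-- Local data near `x₀` that allow to perturb sections in the class `Γ` without changing them on
`D`, in such a way that they do not vanish on `C`: a family of sections `σ` with parameters in a
vector space `F`, and fibrewise maps `T` to `F` that are left inverse to `σ` near `x₀` on `C`. -/
structure LocalFrame (f : ContinuousInvolution X) {E : X → Type*} [∀ x, AddCommGroup (E x)]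
    (Γ : Set (∀ x, E x)) (D C : Set X) (F : Type*) [NormedAddCommGroup F]
    [NormedSpace ℝ F] (x₀ : X) where
  /-- the neighbourhood of `x₀` -/
  N : Set X
  mem_nhds : N ∈ 𝓝 x₀
  /-- the normed space in which the neighbourhood embeds -/
  G : Type
  [normedAddCommGroup : NormedAddCommGroup G]
  [normedSpace : NormedSpace ℝ G]
  [finiteDimensional : FiniteDimensional ℝ G]
  /-- the embedding of the neighbourhood -/
  ι : X → G
  finrank_lt : Module.finrank ℝ G < Module.finrank ℝ F
  continuousOn_ι : ContinuousOn ι (N ∩ C)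
  injOn_ι : Set.InjOn ι (N ∩ C)
  fixed : ∀ y ∈ N ∩ C, f.toFun y ∈ N ∩ C → f.toFun y = y
  /-- the sections used for perturbation -/
  σ : F → ∀ x, E x
  /-- the coordinates -/
  T : ∀ x, E x →+ F
  T_σ : ∀ y ∈ N ∩ C, ∀ a, T y (σ a y) = a
  continuousOn_T : ∀ s ∈ Γ, ContinuousOn (fun y => T y (s y)) (N ∩ C)
  add_mem : ∀ s ∈ Γ, ∀ h : C(X, F), (∀ x, h (f.toFun x) = h x) → (fun x => s x + σ (h x) x) ∈ Γ
  isOpen_ne : ∀ s ∈ Γ, IsOpen {q : X × F | s q.1 + σ q.2 q.1 ≠ 0}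
  σ_eq_zero : ∀ x ∈ D, ∀ a, σ a x = 0
  σ_zero : ∀ x, σ 0 x = 0

attribute [instance] LocalFrame.normedAddCommGroup LocalFrame.normedSpace
  LocalFrame.finiteDimensional

section GeneralPosition

variable {f : ContinuousInvolution X} {E : X → Type*} [∀ x, AddCommGroup (E x)]
  {Γ : Set (∀ x, E x)} {D C : Set X}

theorem LocalFrame.exists_perturbation [T2Space X] [CompactSpace X] {F : Type*}
    [NormedAddCommGroup F] [NormedSpace ℝ F] [FiniteDimensional ℝ F] {x₀ : X}
    (φ : LocalFrame f Γ D C F x₀) {A : Set X} (hA : IsClosed A) (hAN : A ⊆ φ.N ∩ C)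
    {s : ∀ x, E x} (hs : s ∈ Γ) {K : Set X} (hK : IsCompact K) (hsK : ∀ x ∈ K, s x ≠ 0) :
    ∃ s' ∈ Γ, (∀ x ∈ K ∪ A, s' x ≠ 0) ∧ ∀ x ∈ D, s' x = s x := by
  -- The tube lemma around `K × {0}`: perturbations with parameter of norm at most `ε` create no
  -- zeros on `K`.
  obtain ⟨ε, hε, hKε⟩ : ∃ ε > 0, ∀ x ∈ K, ∀ a : F, ‖a‖ ≤ ε → s x + φ.σ a x ≠ 0 := by
    obtain ⟨U, V, hU, hV, hKU, h0V, hUV⟩ := generalized_tube_lemma hK (isCompact_singleton (x := (0 : F)))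
      (φ.isOpen_ne s hs) (by
        rintro ⟨x, a⟩ ⟨hx, rfl : a = 0⟩
        simpa [φ.σ_zero] using hsK x hx)
    obtain ⟨δ, hδ, hδV⟩ := Metric.isOpen_iff.1 hV 0 (h0V rfl)
    refine ⟨δ / 2, half_pos hδ, fun x hx a ha => @hUV (x, a) ⟨hKU hx, hδV ?_⟩⟩
    rw [mem_ball_zero_iff]
    linarith
  have : CompactSpace A := isCompact_iff_compactSpace.1 hA.isCompact
  obtain ⟨g', hg'0, hg'⟩ := exists_nonvanishing_approx φ.finrank_lt
    ⟨A.domRestrict φ.ι, continuousOn_iff_continuous_domRestrict.1 (φ.continuousOn_ι.mono hAN)⟩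
    (Set.injOn_iff_injective.1 (φ.injOn_ι.mono hAN))
    ⟨A.domRestrict fun y => φ.T y (s y),
      continuousOn_iff_continuous_domRestrict.1 ((φ.continuousOn_T s hs).mono hAN)⟩ hε
  -- The parameter is `h = g' - T s` on `A`, so that the perturbed section has coordinate `T s + h =
  -- g' ≠ 0` there.
  obtain ⟨h, hf, hhε, hhg⟩ := exists_invariant_extension f hA
    (fun y hy hfy => φ.fixed y (hAN hy) (hAN hfy)) (g' - ⟨A.domRestrict fun y => φ.T y (s y),
      continuousOn_iff_continuous_domRestrict.1 ((φ.continuousOn_T s hs).mono hAN)⟩) hε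
      (fun x => (hg' x).le)
  refine ⟨_, φ.add_mem s hs h hf, ?_, fun x hx => by rw [φ.σ_eq_zero x hx, add_zero]⟩
  rintro x (hx | hx)
  · exact hKε x hx _ (hhε x)
  · intro h0
    have h1 := congrArg (φ.T x) h0
    rw [map_add, φ.T_σ x (hAN hx), hhg ⟨x, hx⟩, map_zero] at h1
    have h2 : φ.T x (s x) + (g' ⟨x, hx⟩ - φ.T x (s x)) = 0 := h1
    exact hg'0 ⟨x, hx⟩ (by rwa [add_sub_cancel] at h2)

/-- General position: sections of a class that admits local perturbations near each point of the
compact set `C` can be perturbed not to vanish on `C`. -/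
theorem exists_nonvanishing [T2Space X] [CompactSpace X] {F : Type*}
    [NormedAddCommGroup F] [NormedSpace ℝ F] [FiniteDimensional ℝ F] (hC : IsClosed C)
    (φ : ∀ x ∈ C, Nonempty (LocalFrame f Γ D C F x)) {s : ∀ x, E x} (hs : s ∈ Γ) {K : Set X}
    (hK : IsCompact K) (hsK : ∀ x ∈ K, s x ≠ 0) :
    ∃ s' ∈ Γ, (∀ x ∈ K ∪ C, s' x ≠ 0) ∧ ∀ x ∈ D, s' x = s x := by
  -- The sets `A` in the induction need not be closed, so nonvanishing is recorded on a compact `K'`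
  -- containing `K ∪ A`; the next perturbation can then preserve it.
  have key := hC.isCompact.induction_on
    (p := fun A => ∀ s ∈ Γ, ∀ K, IsCompact K → (∀ x ∈ K, s x ≠ 0) → ∃ s' ∈ Γ, ∃ K', IsCompact K' ∧
      K ∪ A ⊆ K' ∧ (∀ x ∈ K', s' x ≠ 0) ∧ ∀ x ∈ D, s' x = s x)
    (fun s hs K hK hsK => ⟨s, hs, K, hK, by simp, hsK, fun _ _ => rfl⟩)
    (fun A B hAB hB s hs K hK hsK => by
      obtain ⟨s', hs', K', hK', hsub, h⟩ := hB s hs K hK hsK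
      exact ⟨s', hs', K', hK', (Set.union_subset_union_right K hAB).trans hsub, h⟩)
    (fun A B hA hB s hs K hK hsK => by
      obtain ⟨s', hs', K', hK', hsub, h, hD⟩ := hA s hs K hK hsK
      obtain ⟨s'', hs'', K'', hK'', hsub', h', hD'⟩ := hB s' hs' K' hK' h
      refine ⟨s'', hs'', K'', hK'', ?_, h', fun x hx => (hD' x hx).trans (hD x hx)⟩
      rw [← Set.union_assoc]
      exact (Set.union_subset_union_left B hsub).trans hsub')
    (fun x hx => by
      obtain ⟨ψ⟩ := φ x hx
      obtain ⟨L, hLN, hL⟩ := (closed_nhds_basis x).mem_iff.1 ψ.mem_nhds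
      refine ⟨L ∩ C, Filter.inter_mem (mem_nhdsWithin_of_mem_nhds hLN.1) self_mem_nhdsWithin,
        fun s hs K hK hsK => ?_⟩
      have hcl : IsClosed (L ∩ C) := hLN.2.inter hC
      obtain ⟨s', hs', h, hD⟩ := ψ.exists_perturbation hcl
        (Set.inter_subset_inter_left C hL) hs hK hsK
      exact ⟨s', hs', _, hK.union hcl.isCompact, subset_rfl, h, hD⟩)
  obtain ⟨s', hs', K', -, hsub, h, hD⟩ := key s hs K hK hsK
  exact ⟨s', hs', fun x hx => h x (hsub hx), hD⟩

end GeneralPosition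

/-- Bump functions adapted to a point that is not fixed by the involution. -/
theorem exists_bump_of_not_fixed [T2Space X] [CompactSpace X] (f : ContinuousInvolution X) {x₀ : X}
    (hx₀ : f.toFun x₀ ≠ x₀) {U : Set X} (hU : U ∈ 𝓝 x₀) :
    ∃ N ∈ 𝓝 x₀, ∃ χ : C(X, ℝ), N ⊆ U ∧ tsupport χ ⊆ U ∧ (∀ y ∈ N, χ y = 1) ∧
      (∀ y ∈ N, χ (f.toFun y) = 0) ∧ (∀ y ∈ N, f.toFun y ∉ N) ∧ ∀ y, f.toFun y = y → χ y = 0 := by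
  obtain ⟨U₁, U₂, hU₁, hU₂, h₁, h₂, hd⟩ := t2_separation hx₀.symm
  -- `U'` is disjoint from its image under `f`, so a bump function supported in `U'` vanishes on
  -- `f(N)` and on the fixed points.
  let U' : Set X := interior U ∩ U₁ ∩ f.toFun ⁻¹' U₂
  have hU' : IsOpen U' := (isOpen_interior.inter hU₁).inter (hU₂.preimage f.continuous_toFun)
  have hfree : ∀ y ∈ U', f.toFun y ∉ U' := fun y hy hfy => hd.le_bot ⟨hfy.1.2, hy.2⟩
  obtain ⟨N, hN, hNU⟩ := (closed_nhds_basis x₀).mem_iff.1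
    (hU'.mem_nhds ⟨⟨mem_interior_iff_mem_nhds.2 hU, h₁⟩, h₂⟩)
  obtain ⟨χ, hχ, hχN, -⟩ := exists_tsupport_one_of_isOpen_isClosed hU' isClosed_closure.isCompact
    hN.2 hNU
  have hU'U : U' ⊆ U := fun y hy => interior_subset hy.1.1
  have hχ0 : ∀ y, y ∉ U' → χ y = 0 := fun y hy =>
    image_eq_zero_of_notMem_tsupport fun h => hy (hχ h)
  exact ⟨N, hN.1, χ, hNU.trans hU'U, hχ.trans hU'U, hχN, fun y hy => hχ0 _ (hfree y (hNU hy)),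
    fun y hy hfy => hfree y (hNU hy) (hNU hfy),
    fun y hy => hχ0 y fun h => hfree y h (hy.symm ▸ h)⟩

/-- The fixed point set of an antiholomorphic map locally embeds into the line. -/
theorem IsAntiholomorphic.exists_injOn_fixed {S : Type u} [TopologicalSpace S] [ChartedSpace ℂ S]
    {f : S → S} (hf : IsAntiholomorphic f) {p : S} (hp : f p = p) :
    ∃ N ∈ 𝓝 p, ∃ ι : S → ℝ, ContinuousOn ι N ∧ ∀ x ∈ N, ∀ y ∈ N, f x = x → f y = y →
      ι x = ι y → x = y := by
  set e := chartAt ℂ p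
  have hpe : p ∈ e.source := mem_chart_source ℂ p
  let Ω : Set ℂ := {z | z ∈ e.target ∧ f (e.symm z) ∈ e.source}
  let g : ℂ → ℂ := fun z => (starRingEnd ℂ) (e (f (e.symm z)))
  have hg : DifferentiableOn ℂ g Ω := hf.2 e (chart_mem_atlas ℂ p) e (chart_mem_atlas ℂ p)
  have hΩ : IsOpen Ω :=
    (hf.1.comp_continuousOn e.continuousOn_symm).isOpen_inter_preimage e.open_target e.open_source
  have hpΩ : e p ∈ Ω := ⟨e.map_source hpe, by rw [e.left_inv hpe, hp]; exact hpe⟩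
  have hd : HasStrictDerivAt g (deriv g (e p)) (e p) :=
    (hg.analyticAt (hΩ.mem_nhds hpΩ)).hasStrictDerivAt
  -- `c = 1` works unless the derivative is `-1`, and then `c = i` gives `2i`.
  obtain ⟨c, hc⟩ : ∃ c : ℂ, c + (starRingEnd ℂ) c * deriv g (e p) ≠ 0 := by
    by_cases h : 1 + deriv g (e p) = 0
    · refine ⟨Complex.I, ?_⟩
      rw [eq_neg_of_add_eq_zero_right h, Complex.conj_I]
      simp
    · exact ⟨1, by simpa using h⟩
  -- `ζ` is holomorphic with nonzero derivative, hence injective near `e p`. At a fixed point `g z`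
  -- is the conjugate of `z`, so there `ζ z = 2 Re (c z)` and the real function `Re (c z)` separates
  -- fixed points.
  let ζ : ℂ → ℂ := fun z => c * z + (starRingEnd ℂ) c * g z
  have hζ : HasStrictDerivAt ζ (c + (starRingEnd ℂ) c * deriv g (e p)) (e p) := by
    have h := ((hasStrictDerivAt_id (e p)).const_mul c).add (hd.const_mul ((starRingEnd ℂ) c))
    rw [mul_one] at h
    exact h
  have hinj := hζ.eventually_left_inverse hc
  have hN : {x | x ∈ e.source ∧ hζ.localInverse ζ _ (e p) hc (ζ (e x)) = e x} ∈ 𝓝 p :=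
    Filter.inter_mem (e.open_source.mem_nhds hpe) ((e.continuousAt hpe).eventually hinj)
  refine ⟨_, hN, fun x => (c * e x).re, ?_, ?_⟩
  · exact (Complex.continuous_re.comp (continuous_const_mul c)).comp_continuousOn
      (e.continuousOn.mono fun x hx => hx.1)
  · rintro x ⟨hx, hx'⟩ y ⟨hy, hy'⟩ hfx hfy h
    have key : ∀ z ∈ e.source, f z = z → ζ (e z) = ((2 * (c * e z).re : ℝ) : ℂ) := by
      intro z hz hfz
      simp only [ζ, g]
      rw [e.left_inv hz, hfz, ← map_mul, Complex.add_conj]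
    refine e.injOn hx hy ?_
    change (c * e x).re = (c * e y).re at h
    rw [← hx', ← hy', key x hx hfx, key y hy hfy, h]

/-! ### Nowhere zero equivariant homomorphisms -/

namespace EquivariantBundle

variable {f : ContinuousInvolution X} {V W : EquivariantBundle.{u, v} f}

theorem conj_congr {g g' : ∀ x, V.fiber x →ₗ[ℂ] W.fiber x} {x : X} (hx : f.toFun x = x)
    (h : g x = g' x) : conj V W g x = conj V W g' x := by
  have : ∀ y, y = x → g y = g' y := by
    rintro _ rfl
    exact h
  rw [conj, conj, this _ hx]

variable (V W) in
/-- Continuous equivariant families of linear maps. -/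
def equivariantHoms : Set (∀ x, V.fiber x →ₗ[ℂ] W.fiber x) :=
  {g | IsContHom V W g ∧ IsEquivariant V W g}

variable (V W) in
/-- The equivariant family of linear maps given near `x₀` by a matrix and a bump function. -/
def bumpHom (x₀ : X) (χ : X → ℝ) (a : V.F →L[ℂ] W.F) (x : X) : V.fiber x →ₗ[ℂ] W.fiber x :=
  uncoordAt V W x₀ x ((χ x : ℂ) • a) +
    conj V W (fun y => uncoordAt V W x₀ y ((χ y : ℂ) • a)) x

theorem bumpHom_zero (x₀ : X) (χ : X → ℝ) (x : X) : bumpHom V W x₀ χ 0 x = 0 := by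
  ext v
  simp [bumpHom, conj]

/-- Because `h` is invariant, conjugation commutes with inserting `h x` for the constant matrix; the
family is thus a cut-off family plus its conjugate. -/
theorem bumpHom_mem {x₀ : X} {χ : X → ℝ} (hχ : Continuous χ)
    (hχs : tsupport χ ⊆ V.base x₀ ∩ W.base x₀) {h : X → (V.F →L[ℂ] W.F)} (hh : Continuous h)
    (hf : ∀ x, h (f.toFun x) = h x) :
    (fun x => bumpHom V W x₀ χ (h x) x) ∈ equivariantHoms V W := by
  have e : (fun x => bumpHom V W x₀ χ (h x) x) = fun x => uncoordAt V W x₀ x ((χ x : ℂ) • h x) +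
      conj V W (fun y => uncoordAt V W x₀ y ((χ y : ℂ) • h y)) x := by
    funext x
    simp only [bumpHom, conj, hf x]
  have hc : IsContHom V W fun x => uncoordAt V W x₀ x ((χ x : ℂ) • h x) := by
    refine isContHom_uncoordAt (by fun_prop) (subset_trans ?_ hχs)
    refine closure_mono fun x hx => ?_
    contrapose! hx
    simp [Function.notMem_support.1 hx]
  rw [e]
  exact ⟨hc.add hc.conj, isEquivariant_add_conj _⟩

/-- In coordinates the perturbation is `L x a` with `L x` linear and continuous in `x`, hence
jointly continuous in `(x, a)`. Joint openness is what the tube lemma needs. -/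
theorem isOpen_add_bumpHom_ne {x₀ : X} {χ : X → ℝ} (hχ : Continuous χ)
    (hχs : tsupport χ ⊆ V.base x₀ ∩ W.base x₀) {s : ∀ x, V.fiber x →ₗ[ℂ] W.fiber x}
    (hs : IsContHom V W s) :
    IsOpen {q : X × (V.F →L[ℂ] W.F) | s q.1 + bumpHom V W x₀ χ q.2 q.1 ≠ 0} := by
  refine isOpen_iff_mem_nhds.2 ?_
  rintro ⟨x₁, a₁⟩ h
  let L : X → ((V.F →L[ℂ] W.F) →L[ℂ] (V.F →L[ℂ] W.F)) := fun x => LinearMap.toContinuousLinearMap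
    { toFun := fun a => coordAt V W x₁ x (bumpHom V W x₀ χ a x)
      map_add' := fun a b => by
        rw [← map_add]
        congr 1
        ext v
        simp only [bumpHom, conj, smul_add, map_add, LinearMap.add_apply, LinearMap.comp_apply]
        abel
      map_smul' := fun c a => by
        rw [RingHom.id_apply, ← map_smul]
        congr 1
        ext v
        simp only [bumpHom, conj, smul_comm _ c a, map_smul, LinearMap.smul_apply,
          LinearMap.comp_apply, LinearMap.add_apply, smul_add] }
  have hL : ContinuousAt L x₁ := continuousAt_clm_apply.2 fun a =>
    (bumpHom_mem hχ hχs (h := fun _ => a) continuous_const fun _ => rfl).1.continuousAt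
      (mem_base x₁) (mem_base x₁)
  have hc : ContinuousAt (fun q : X × (V.F →L[ℂ] W.F) => coordAt V W x₁ q.1 (s q.1) + L q.1 q.2)
      (x₁, a₁) := by
    refine ContinuousAt.add ?_ (ContinuousAt.clm_apply ?_ continuousAt_snd)
    · exact ContinuousAt.comp (f := fun q : X × (V.F →L[ℂ] W.F) => q.1) (x := (x₁, a₁))
        (hs.continuousAt (mem_base x₁) (mem_base x₁)) continuousAt_fst
    · exact ContinuousAt.comp (f := fun q : X × (V.F →L[ℂ] W.F) => q.1) (x := (x₁, a₁))
        hL continuousAt_fst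
  have key : ∀ q : X × (V.F →L[ℂ] W.F), coordAt V W x₁ q.1 (s q.1) + L q.1 q.2 =
      coordAt V W x₁ q.1 (s q.1 + bumpHom V W x₀ χ q.2 q.1) := fun q => (map_add _ _ _).symm
  have h0 : coordAt V W x₁ x₁ (s x₁) + L x₁ a₁ ≠ 0 := by
    rw [key (x₁, a₁)]
    exact fun h' => h (coordAt_injective (mem_base x₁) (mem_base x₁) (h'.trans (map_zero _).symm))
  filter_upwards [hc.eventually_ne h0] with q hq hq'
  rw [key, hq', map_zero] at hq
  exact hq rfl

theorem IsContHom.isOpen_ne {s : ∀ x, V.fiber x →ₗ[ℂ] W.fiber x} (hs : IsContHom V W s) :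
    IsOpen {x | s x ≠ 0} := by
  refine isOpen_iff_mem_nhds.2 fun x₁ h => ?_
  have h0 : coordAt V W x₁ x₁ (s x₁) ≠ 0 := fun h' =>
    h (coordAt_injective (mem_base x₁) (mem_base x₁) (h'.trans (map_zero _).symm))
  filter_upwards [(hs.continuousAt (mem_base x₁) (mem_base x₁)).eventually_ne h0] with x hx hx'
  exact hx (by rw [hx', map_zero])

theorem equivariantHoms_add {s s' : ∀ x, V.fiber x →ₗ[ℂ] W.fiber x} (hs : s ∈ equivariantHoms V W)
    (hs' : s' ∈ equivariantHoms V W) : (fun x => s x + s' x) ∈ equivariantHoms V W :=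
  ⟨hs.1.add hs'.1, hs.2.add hs'.2⟩

/-- Local frames of the bundle of homomorphisms near a point that is not fixed. -/
theorem nonempty_localFrame_of_not_fixed [T2Space X] [CompactSpace X] [ChartedSpace ℂ X]
    (hr : 1 < Module.finrank ℂ V.F * Module.finrank ℂ W.F) {x₀ : X} (hx₀ : f.toFun x₀ ≠ x₀)
    (C : Set X) :
    Nonempty (LocalFrame f (equivariantHoms V W) ∅ C (V.F →L[ℂ] W.F) x₀) := by
  have hU : (chartAt ℂ x₀).source ∩ (V.base x₀ ∩ W.base x₀) ∈ 𝓝 x₀ :=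
    Filter.inter_mem (chart_source_mem_nhds ℂ x₀)
      (Filter.inter_mem (base_mem_nhds (mem_base x₀)) (base_mem_nhds (mem_base x₀)))
  obtain ⟨N, hN, χ, hNU, hχU, hχ1, hχ0, hfree, -⟩ := exists_bump_of_not_fixed f hx₀ hU
  have hχs : tsupport χ ⊆ V.base x₀ ∩ W.base x₀ := fun x hx => (hχU hx).2
  exact ⟨{
    N := N
    mem_nhds := hN
    G := ℂ
    ι := chartAt ℂ x₀
    finrank_lt := by
      rw [Complex.finrank_real_complex, ← Module.finrank_mul_finrank ℝ ℂ (V.F →L[ℂ] W.F),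
        Complex.finrank_real_complex, (LinearMap.toContinuousLinearMap
          (𝕜 := ℂ) (E := V.F) (F' := W.F)).symm.finrank_eq, Module.finrank_linearMap]
      omega
    continuousOn_ι := (chartAt ℂ x₀).continuousOn.mono fun x hx => (hNU hx.1).1
    injOn_ι := (chartAt ℂ x₀).injOn.mono fun x hx => (hNU hx.1).1
    fixed := fun y hy hfy => absurd hfy.1 (hfree y hy.1)
    σ := bumpHom V W x₀ χ
    T := fun x => (coordAt V W x₀ x).toAddMonoidHom
    T_σ := fun y hy a => by
      -- On `N` the conjugate term is zero, since `χ` vanishes at `f y`.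
      have e : bumpHom V W x₀ χ a y = uncoordAt V W x₀ y a := by
        rw [bumpHom, conj, hχ1 y hy.1, hχ0 y hy.1]
        simp
      change coordAt V W x₀ y (bumpHom V W x₀ χ a y) = a
      rw [e, coordAt_uncoordAt (hNU hy.1).2.1 (hNU hy.1).2.2]
    continuousOn_T := fun s hs y hy =>
      (hs.1.continuousAt (hNU hy.1).2.1 (hNU hy.1).2.2).continuousWithinAt
    add_mem := fun s hs h hf =>
      equivariantHoms_add hs (bumpHom_mem χ.continuous hχs h.continuous hf)
    isOpen_ne := fun s hs => isOpen_add_bumpHom_ne χ.continuous hχs hs.1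
    σ_eq_zero := fun x hx => hx.elim
    σ_zero := bumpHom_zero x₀ χ }⟩

/-- Local frames of the bundle of homomorphisms near a fixed point with a nonzero equivariant
homomorphism. -/
theorem nonempty_localFrame_of_fixed [T2Space X] [CompactSpace X] [ChartedSpace ℂ X]
    (hf : IsAntiholomorphic f.toFun) {x₀ : X} (hx₀ : f.toFun x₀ = x₀)
    {g : ∀ x, V.fiber x →ₗ[ℂ] W.fiber x} (hg : conj V W g x₀ = g x₀) (hg0 : g x₀ ≠ 0) :
    Nonempty (LocalFrame f (equivariantHoms V W) ∅ {x | f.toFun x = x} ℂ x₀) := by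
  obtain ⟨N₀, hN₀, ι, hι, hinj⟩ := hf.exists_injOn_fixed hx₀
  obtain ⟨χ, hχs, hχ1, -⟩ := exists_tsupport_one_of_isOpen_isClosed
    ((isOpen_base (V := V) x₀).inter (isOpen_base (V := W) x₀)) isClosed_closure.isCompact
    (isClosed_singleton (x := x₀)) (by
      rintro _ rfl
      exact ⟨mem_base _, mem_base _⟩)
  let c : V.F →L[ℂ] W.F := coordAt V W x₀ x₀ (g x₀)
  -- At a fixed point the cut-off family and its conjugate both equal `g x₀`.
  have hc : bumpHom V W x₀ χ c x₀ = (2 : ℂ) • g x₀ := by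
    have h1 : uncoordAt V W x₀ x₀ ((χ x₀ : ℂ) • c) = g x₀ := by
      rw [hχ1 rfl, Pi.one_apply, Complex.ofReal_one, one_smul,
        uncoordAt_coordAt (mem_base x₀) (mem_base x₀)]
    rw [bumpHom, h1, conj_congr (g' := g) hx₀ h1, hg, two_smul]
  have hmem : bumpHom V W x₀ χ c ∈ equivariantHoms V W :=
    bumpHom_mem χ.continuous hχs (h := fun _ => c) continuous_const fun _ => rfl
  have hne : coordAt V W x₀ x₀ (bumpHom V W x₀ χ c x₀) ≠ 0 := by
    intro h
    have := coordAt_injective (mem_base x₀) (mem_base x₀) (h.trans (map_zero _).symm)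
    rw [hc] at this
    exact hg0 ((smul_eq_zero.1 this).resolve_left two_ne_zero)
  -- Only the complex line spanned by `c` is used for perturbation. The functional `l` detects it
  -- near `x₀`, and `T` is `l` normalized by `t`.
  obtain ⟨l, hl⟩ := SeparatingDual.exists_eq_one (R := ℂ) hne
  let t : X → ℂ := fun x => l (coordAt V W x₀ x (bumpHom V W x₀ χ c x))
  have hbase : V.base x₀ ∩ W.base x₀ ∈ 𝓝 x₀ :=
    Filter.inter_mem (base_mem_nhds (mem_base x₀)) (base_mem_nhds (mem_base x₀))
  have ht : ∀ x ∈ V.base x₀ ∩ W.base x₀, ContinuousAt t x := fun x hx =>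
    ContinuousAt.comp (f := fun x => coordAt V W x₀ x (bumpHom V W x₀ χ c x)) (x := x)
      l.continuous.continuousAt (hmem.1.continuousAt hx.1 hx.2)
  have hN : N₀ ∩ ((V.base x₀ ∩ W.base x₀) ∩ {x | t x ≠ 0}) ∈ 𝓝 x₀ :=
    Filter.inter_mem hN₀ (Filter.inter_mem hbase
      ((ht x₀ ⟨mem_base x₀, mem_base x₀⟩).eventually_ne (hl.trans_ne one_ne_zero)))
  have hsmul : ∀ (a : ℂ) x, bumpHom V W x₀ χ (a • c) x = a • bumpHom V W x₀ χ c x := fun a x => by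
    ext v
    simp only [bumpHom, conj, smul_comm _ a c, map_smul, LinearMap.smul_apply,
      LinearMap.comp_apply, LinearMap.add_apply, smul_add]
  exact ⟨{
    N := _
    mem_nhds := hN
    G := ℝ
    ι := ι
    finrank_lt := by simp
    continuousOn_ι := hι.mono fun x hx => hx.1.1
    injOn_ι := fun x hx y hy => hinj x hx.1.1 y hy.1.1 hx.2 hy.2
    fixed := fun y hy _ => hy.2
    σ := fun a => bumpHom V W x₀ χ (a • c)
    T := fun x => ((t x)⁻¹ • (l.toLinearMap ∘ₗ coordAt V W x₀ x)).toAddMonoidHom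
    T_σ := fun y hy a => by
      change (t y)⁻¹ • l (coordAt V W x₀ y (bumpHom V W x₀ χ (a • c) y)) = a
      rw [hsmul, map_smul, map_smul]
      change (t y)⁻¹ * (a * t y) = a
      have : t y ≠ 0 := hy.1.2.2
      field_simp
    continuousOn_T := fun s hs y hy => by
      have hb := hy.1.2.1
      refine ContinuousAt.continuousWithinAt (((ht y hb).inv₀ hy.1.2.2).smul ?_)
      exact ContinuousAt.comp (f := fun x => coordAt V W x₀ x (s x)) (x := y)
        l.continuous.continuousAt (hs.1.continuousAt hb.1 hb.2)
    add_mem := fun s hs h hf => equivariantHoms_add hs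
      (bumpHom_mem χ.continuous hχs (h := fun x => h x • c) (by fun_prop) fun x => by rw [hf x])
    isOpen_ne := fun s hs => (isOpen_add_bumpHom_ne χ.continuous hχs hs.1).preimage
      (f := fun q : X × ℂ => (q.1, q.2 • c)) (by fun_prop)
    σ_eq_zero := fun x hx => hx.elim
    σ_zero := fun x => by rw [zero_smul, bumpHom_zero] }⟩

/-- General position for equivariant homomorphisms over a compact surface with an antiholomorphic
involution. -/
theorem exists_equivariantHom_ne_zero [T2Space X] [CompactSpace X] [ChartedSpace ℂ X]
    (hf : IsAntiholomorphic f.toFun) (hr : 1 < Module.finrank ℂ V.F * Module.finrank ℂ W.F)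
    (hfix : ∀ x, f.toFun x = x → ∃ g : ∀ x, V.fiber x →ₗ[ℂ] W.fiber x,
      conj V W g x = g x ∧ g x ≠ 0) :
    ∃ g ∈ equivariantHoms V W, ∀ x, g x ≠ 0 := by
  have hB : IsClosed {x | f.toFun x = x} := isClosed_eq f.continuous_toFun continuous_id
  have h0 : (fun _ => 0) ∈ equivariantHoms V W := ⟨isContHom_zero, fun _ _ => by simp⟩
  obtain ⟨s, hs, hsB, -⟩ := exists_nonvanishing hB (fun x hx => by
    obtain ⟨g, hg, hg0⟩ := hfix x hx
    exact nonempty_localFrame_of_fixed hf hx hg hg0) h0 isCompact_empty (fun _ hx => hx.elim)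
  -- With zeros removed on the fixed set, nonvanishing persists on the closure of a neighbourhood
  -- `O`. The remaining points are not fixed, and there all matrices are available for perturbation.
  obtain ⟨O, hO, hBO, hOs⟩ := normal_exists_closure_subset hB hs.1.isOpen_ne
    (fun x hx => hsB x (Or.inr hx))
  obtain ⟨g, hg, hg0, -⟩ := exists_nonvanishing hO.isClosed_compl
    (fun x hx => nonempty_localFrame_of_not_fixed hr (fun h => hx (hBO h)) _) hs
    isClosed_closure.isCompact (fun x hx => hOs hx)
  refine ⟨g, hg, fun x => hg0 x ?_⟩
  by_cases hx : x ∈ O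
  · exact Or.inl (subset_closure hx)
  · exact Or.inr hx

end EquivariantBundle

/-! ### Equivariant line bundles with prescribed signs -/

/-- On a surface with an involution there is a nowhere vanishing function with values in `ℂ × ℝ`
with odd first and even second component, and with prescribed sign on the fixed point set. -/
theorem exists_odd_even_ne_zero [T2Space X] [CompactSpace X] [ChartedSpace ℂ X]
    (f : ContinuousInvolution X) {B₁ B₂ : Set X} (hB₁ : IsClosed B₁) (hB₂ : IsClosed B₂)
    (hd : Disjoint B₁ B₂) (hB : B₁ ∪ B₂ = {x | f.toFun x = x}) :
    ∃ s : X → ℂ × ℝ, Continuous s ∧ (∀ x, s (f.toFun x) = (-(s x).1, (s x).2)) ∧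
      (∀ x, s x ≠ 0) ∧ (∀ x ∈ B₁, s x = (0, -1)) ∧ ∀ x ∈ B₂, s x = (0, 1) := by
  let Γ : Set (X → ℂ × ℝ) := {s | Continuous s ∧ ∀ x, s (f.toFun x) = (-(s x).1, (s x).2)}
  have hf := f.continuous_toFun
  obtain ⟨u, hu1, hu2, -⟩ := exists_continuous_zero_one_of_isClosed hB₁ hB₂ hd
  -- Symmetrizing the Urysohn function gives the values `0 + 0 - 1` on `B₁` and `1 + 1 - 1` on `B₂`.
  let s₀ : X → ℂ × ℝ := fun x => (0, u x + u (f.toFun x) - 1)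
  have hs₀ : s₀ ∈ Γ := by
    refine ⟨by fun_prop, fun x => ?_⟩
    simp only [s₀, f.involutive x, neg_zero]
    rw [add_comm]
  have h1 : ∀ x ∈ B₁, s₀ x = (0, -1) := fun x hx => by
    have hfx : f.toFun x = x := hB.subset (Or.inl hx)
    simp [s₀, hfx, hu1 hx]
  have h2 : ∀ x ∈ B₂, s₀ x = (0, 1) := fun x hx => by
    have hfx : f.toFun x = x := hB.subset (Or.inr hx)
    simp [s₀, hfx, hu2 hx]
  obtain ⟨O, hO, hBO, hOs⟩ := normal_exists_closure_subset (hB₁.union hB₂)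
    (isOpen_ne_fun hs₀.1 continuous_const : IsOpen {x | s₀ x ≠ 0}) (by
      rintro x (hx | hx)
      · simp [h1 x hx]
      · simp [h2 x hx])
  obtain ⟨s, hs, hs0, hsB⟩ := exists_nonvanishing (f := f) (Γ := Γ) (D := B₁ ∪ B₂) (F := ℂ × ℝ)
    hO.isClosed_compl (fun x hx => by
      have hfx : f.toFun x ≠ x := fun h => hx (hBO (hB ▸ h))
      obtain ⟨N, hN, χ, hNU, -, hχ1, hχ0, hfree, hχB⟩ := exists_bump_of_not_fixed f hfx
        (chart_source_mem_nhds ℂ x)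
      exact ⟨{
        N := N
        mem_nhds := hN
        G := ℂ
        ι := chartAt ℂ x
        finrank_lt := by simp
        continuousOn_ι := (chartAt ℂ x).continuousOn.mono fun y hy => hNU hy.1
        injOn_ι := (chartAt ℂ x).injOn.mono fun y hy => hNU hy.1
        fixed := fun y hy hfy => absurd hfy.1 (hfree y hy.1)
        -- The second term makes the perturbation odd in the first and even in the second component.
        σ := fun a y => χ y • a + χ (f.toFun y) • (-a.1, a.2)
        T := fun _ => AddMonoidHom.id _
        T_σ := fun y hy a => by simp [hχ1 y hy.1, hχ0 y hy.1]
        continuousOn_T := fun s hs => hs.1.continuousOn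
        add_mem := fun s hs h hh => by
          have := hs.1
          refine ⟨by fun_prop, fun y => ?_⟩
          simp only [hs.2 y, hh y, f.involutive y]
          ext <;> simp <;> ring
        isOpen_ne := fun s hs => by
          have := hs.1
          exact isOpen_ne_fun (by fun_prop) continuous_const
        σ_eq_zero := fun y hy a => by
          have hfy : f.toFun y = y := hB.subset hy
          simp [hfy, hχB y hfy]
        σ_zero := fun y => by simp }⟩) hs₀ isClosed_closure.isCompact (fun x hx => hOs hx)
  refine ⟨s, hs.1, hs.2, fun x => hs0 x ?_, fun x hx => (hsB x (Or.inl hx)).trans (h1 x hx),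
    fun x hx => (hsB x (Or.inr hx)).trans (h2 x hx)⟩
  by_cases hx : x ∈ O
  · exact Or.inl (subset_closure hx)
  · exact Or.inr hx

/-- The rank of an idempotent is its trace. -/
theorem finrank_range_eq_trace {M : Type*} [AddCommGroup M] [Module ℂ M] [FiniteDimensional ℂ M]
    {p : M →ₗ[ℂ] M} (hp : ∀ v, p (p v) = p v) :
    (Module.finrank ℂ (LinearMap.range p) : ℂ) = LinearMap.trace ℂ M p :=
  (LinearMap.IsProj.trace (p := LinearMap.range p) (f := p)
    ⟨fun x => ⟨x, rfl⟩, by rintro _ ⟨x, rfl⟩; exact hp x⟩).symm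

/-- The traceless hermitian `2 × 2` matrix with entries given by `q`. -/
def pauli (q : ℂ × ℝ) : ℂ × ℂ →ₗ[ℂ] ℂ × ℂ where
  toFun a := (q.2 * a.1 + q.1 * a.2, (starRingEnd ℂ) q.1 * a.1 - q.2 * a.2)
  map_add' a b := by ext <;> simp <;> ring
  map_smul' c a := by ext <;> simp <;> ring

/-- The positive eigenvalue of `pauli q`. -/
def pauliNorm (q : ℂ × ℝ) : ℝ := √(Complex.normSq q.1 + q.2 ^ 2)

theorem pauliNorm_pos {q : ℂ × ℝ} (hq : q ≠ 0) : 0 < pauliNorm q := by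
  refine Real.sqrt_pos.2 ?_
  by_cases h : q.1 = 0
  · have h2 : q.2 ≠ 0 := fun h2 => hq (Prod.ext h h2)
    have := Complex.normSq_nonneg q.1
    positivity
  · have := Complex.normSq_pos.2 h
    positivity

theorem pauliNorm_sq (q : ℂ × ℝ) : pauliNorm q ^ 2 = Complex.normSq q.1 + q.2 ^ 2 :=
  Real.sq_sqrt (add_nonneg (Complex.normSq_nonneg _) (sq_nonneg _))

theorem pauli_pauli (q : ℂ × ℝ) (a : ℂ × ℂ) :
    pauli q (pauli q a) = ((pauliNorm q : ℂ) ^ 2) • a := by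
  have h : (pauliNorm q : ℂ) ^ 2 = q.1 * (starRingEnd ℂ) q.1 + q.2 ^ 2 := by
    rw [Complex.mul_conj]
    exact_mod_cast congrArg Complex.ofReal (pauliNorm_sq q)
  rw [h]
  ext <;> simp [pauli] <;> ring

/-- The projection to the eigenspace of `pauli q` for the positive eigenvalue. -/
def pauliProj (q : ℂ × ℝ) : ℂ × ℂ →ₗ[ℂ] ℂ × ℂ :=
  (2⁻¹ : ℂ) • (LinearMap.id + (pauliNorm q : ℂ)⁻¹ • pauli q)

/-- The matrix squares to the scalar `n²` with `n = pauliNorm q`, so dividing it by `n` gives an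
involution. -/
theorem pauliProj_pauliProj {q : ℂ × ℝ} (hq : q ≠ 0) (a : ℂ × ℂ) :
    pauliProj q (pauliProj q a) = pauliProj q a := by
  have h : (pauliNorm q : ℂ) ≠ 0 := Complex.ofReal_ne_zero.2 (pauliNorm_pos hq).ne'
  simp only [pauliProj, LinearMap.smul_apply, LinearMap.add_apply, LinearMap.id_apply, map_smul,
    map_add, pauli_pauli]
  have : (pauliNorm q : ℂ)⁻¹ • (pauliNorm q : ℂ)⁻¹ • ((pauliNorm q : ℂ) ^ 2 • a) = a := by
    rw [smul_smul, smul_smul]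
    field_simp
    exact one_smul _ _
  rw [smul_comm ((pauliNorm q : ℂ)⁻¹) (2⁻¹ : ℂ), smul_add ((pauliNorm q : ℂ)⁻¹), this]
  module

/-- `pauli q` is traceless, so only half the identity contributes; this makes the eigenspace a line.
-/
theorem trace_pauliProj (q : ℂ × ℝ) : LinearMap.trace ℂ _ (pauliProj q) = 1 := by
  rw [LinearMap.trace_eq_matrix_trace ℂ (Module.Basis.finTwoProd ℂ), Matrix.trace_fin_two]
  simp [LinearMap.toMatrix_apply, pauliProj, pauli]
  ring

namespace EquivariantBundle

/-- The trivial bundle with the involution given by a linear involution of the fibre. -/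
def trivialBundle (f : ContinuousInvolution X) (F : Type v) [NormedAddCommGroup F] [NormedSpace ℂ F]
    [FiniteDimensional ℂ F] (A : F →ₗ[ℂ] F) (hA : ∀ a, A (A a) = a) :
    EquivariantBundle.{u, v} f where
  F := F
  fiber := Bundle.Trivial X F
  lift _ := A
  continuous_lift := by
    rw [(Bundle.Trivial.isInducing_toProd X F).continuous_iff]
    have h := (Bundle.Trivial.isInducing_toProd X F).continuous
    exact (f.continuous_toFun.comp (continuous_fst.comp h)).prodMk
      (A.continuous_of_finiteDimensional.comp (continuous_snd.comp h))
  involutive_lift p := by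
    obtain ⟨x, y⟩ := p
    change (⟨f.toFun (f.toFun x), A (A y)⟩ : TotalSpace F (Bundle.Trivial X F)) = ⟨x, y⟩
    rw [hA, f.involutive x]

theorem isContHom_trivialBundle {f : ContinuousInvolution X} {F : Type v} [NormedAddCommGroup F]
    [NormedSpace ℂ F] [FiniteDimensional ℂ F] {A : F →ₗ[ℂ] F} (hA : ∀ a, A (A a) = a)
    {m : X → F →ₗ[ℂ] F} (hm : Continuous fun p : X × F => m p.1 p.2) :
    IsContHom (trivialBundle f F A hA) (trivialBundle f F A hA) m := by
  refine (Bundle.Trivial.isInducing_toProd X F).continuous_iff.2 ?_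
  have h := (Bundle.Trivial.isInducing_toProd X F).continuous
  exact (continuous_fst.comp h).prodMk (hm.comp h)

/-- Existence of equivariant line bundles with prescribed signs over the fixed point set. -/
theorem exists_lineBundle [T2Space X] [CompactSpace X] [ChartedSpace ℂ X]
    (f : ContinuousInvolution X) {B₁ B₂ : Set X} (hB₁ : IsClosed B₁) (hB₂ : IsClosed B₂)
    (hd : Disjoint B₁ B₂) (hB : B₁ ∪ B₂ = {x | f.toFun x = x}) :
    ∃ L : EquivariantBundle.{u, v} f, Module.finrank ℂ L.F = 1 ∧
      (∀ x ∈ B₁, ∀ v, L.totalLift ⟨x, v⟩ = ⟨x, -v⟩) ∧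
      ∀ x ∈ B₂, ∀ v, L.totalLift ⟨x, v⟩ = ⟨x, v⟩ := by
  obtain ⟨s, hs, hsf, hs0, hs1, hs2⟩ := exists_odd_even_ne_zero f hB₁ hB₂ hd hB
  -- A copy of `ℂ²` in the universe of the fibres.
  obtain ⟨κ⟩ : Nonempty (Projection.Model.{v} 2 ≃ₗ[ℂ] ℂ × ℂ) :=
    FiniteDimensional.nonempty_linearEquiv_of_finrank_eq (by simp)
  let R : ℂ × ℂ →ₗ[ℂ] ℂ × ℂ := LinearMap.prodMap LinearMap.id (-LinearMap.id)
  have hR : ∀ a, R a = (a.1, -a.2) := fun a => rfl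
  let A := κ.symm.conj R
  have hAκ : ∀ a, κ (A a) = R (κ a) := fun a => by simp [A, LinearEquiv.conj_apply]
  have hA : ∀ a, A (A a) = a := fun a => κ.injective (by rw [hAκ, hAκ, hR, hR]; simp)
  have hκ : Continuous κ := κ.toLinearMap.continuous_of_finiteDimensional
  have hκ' : Continuous κ.symm := κ.symm.toLinearMap.continuous_of_finiteDimensional
  have hn : Continuous fun x => (pauliNorm (s x) : ℂ)⁻¹ :=
    Continuous.inv₀ (by unfold pauliNorm; fun_prop)
      fun x => Complex.ofReal_ne_zero.2 (pauliNorm_pos (hs0 x)).ne'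
  -- Conjugation by `diag(1, -1)` negates the off-diagonal entries, matching the parity of `s`.
  have hconj : ∀ q : ℂ × ℝ, pauliProj (-q.1, q.2) ∘ₗ R = R ∘ₗ pauliProj q := by
    intro q
    have hnq : pauliNorm (-q.1, q.2) = pauliNorm q := by simp [pauliNorm]
    ext <;> simp [pauliProj, pauli, hR, hnq]
    ring
  let p : X → Projection.Model.{v} 2 →ₗ[ℂ] Projection.Model.{v} 2 :=
    fun x => κ.symm.conj (pauliProj (s x))
  have hpκ : ∀ x v, κ (p x v) = pauliProj (s x) (κ v) := fun x v => by
    simp [p, LinearEquiv.conj_apply]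
  have hp : ∀ x v, p x (p x v) = p x v := fun x v => κ.injective (by
    rw [hpκ, hpκ, pauliProj_pauliProj (hs0 x)])
  have hpc : Continuous fun q : X × Projection.Model.{v} 2 => p q.1 q.2 := by
    have h1 : Continuous fun q : X × Projection.Model.{v} 2 => (pauliNorm (s q.1) : ℂ)⁻¹ :=
      hn.comp continuous_fst
    refine (hκ'.comp (g := κ.symm) (f := fun q : X × Projection.Model.{v} 2 =>
      pauliProj (s q.1) (κ q.2)) ?_).congr fun q => by
        rw [Function.comp, ← hpκ, κ.symm_apply_apply]
    simp only [pauliProj, pauli, LinearMap.smul_apply, LinearMap.add_apply, LinearMap.id_apply,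
      LinearMap.coe_mk, AddHom.coe_mk]
    fun_prop
  have hpA : ∀ x (v : Projection.Model.{v} 2), p (f.toFun x) (A v) = A (p x v) := fun x v => by
    apply κ.injective
    rw [hpκ, hAκ, hAκ, hpκ, hsf]
    exact LinearMap.congr_fun (hconj (s x)) (κ v)
  -- At `(0, -1)` the positive eigenline is the second axis, where `R` is `-1`; at `(0, 1)` it is
  -- the first axis, where `R` is `1`.
  have hp1 : ∀ x ∈ B₁, ∀ w : Projection.Model.{v} 2, A (p x w) = -p x w :=
    fun x hx w => κ.injective (by
      rw [hAκ, map_neg, hpκ, hs1 x hx]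
      ext <;> simp [hR, pauliProj, pauli, pauliNorm])
  have hp2 : ∀ x ∈ B₂, ∀ w : Projection.Model.{v} 2, A (p x w) = p x w :=
    fun x hx w => κ.injective (by
      rw [hAκ, hpκ, hs2 x hx]
      ext <;> simp [hR, pauliProj, pauli, pauliNorm])
  let P : Projection (trivialBundle f (Projection.Model.{v} 2) A hA) 1 :=
    { map := p
      idem := hp
      isContHom := isContHom_trivialBundle hA hpc
      isEquivariant := hpA
      finrank_range := fun x => by
        have h := finrank_range_eq_trace (hp x)
        rw [show LinearMap.trace ℂ _ (p x) = 1 from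
          (LinearMap.trace_conj' _ _).trans (trace_pauliProj _)] at h
        exact_mod_cast h }
  refine ⟨P.bundle, P.finrank_bundle, ?_, ?_⟩
  · intro x hx v
    have hfx : f.toFun x = x := hB.subset (Or.inl hx)
    apply P.incl_injective
    obtain ⟨_, w, rfl⟩ := v
    change (⟨f.toFun x, A (p x w)⟩ : TotalSpace _ (Bundle.Trivial X (Projection.Model.{v} 2))) =
      ⟨x, -p x w⟩
    rw [hp1 x hx w, hfx]
  · intro x hx v
    have hfx : f.toFun x = x := hB.subset (Or.inr hx)
    apply P.incl_injective
    obtain ⟨_, w, rfl⟩ := v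
    change (⟨f.toFun x, A (p x w)⟩ : TotalSpace _ (Bundle.Trivial X (Projection.Model.{v} 2))) =
      ⟨x, p x w⟩
    rw [hp2 x hx w, hfx]

end EquivariantBundle

/-! ### Splitting off a line subbundle -/

namespace EquivariantBundle

variable {f : ContinuousInvolution X} {L V W : EquivariantBundle.{u, v} f}

theorem trace_coordAt {x₀ x : X} (hx : x ∈ V.base x₀) (g : V.fiber x →ₗ[ℂ] V.fiber x) :
    LinearMap.trace ℂ V.F (coordAt V V x₀ x g : V.F →ₗ[ℂ] V.F) = LinearMap.trace ℂ _ g :=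
  LinearMap.trace_conj' g (V.coEquiv hx)

theorem IsContHom.sub {g g' : ∀ x, V.fiber x →ₗ[ℂ] W.fiber x} (hg : IsContHom V W g)
    (hg' : IsContHom V W g') : IsContHom V W (fun x => g x - g' x) :=
  isContHom_of_coordAt fun x₀ => by
    simp only [map_sub]
    exact (hg.continuousAt (mem_base x₀) (mem_base x₀)).sub
      (hg'.continuousAt (mem_base x₀) (mem_base x₀))

theorem IsEquivariant.sub {g g' : ∀ x, V.fiber x →ₗ[ℂ] W.fiber x} (hg : IsEquivariant V W g)
    (hg' : IsEquivariant V W g') : IsEquivariant V W (fun x => g x - g' x) := fun x v => by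
  simp [hg x v, hg' x v]

/-- Near each point there is a map backwards whose composition with a given injective family has
positive trace, and which is supported near that point. -/
theorem exists_local_trace_pos [T2Space X] [CompactSpace X] (hL : Module.finrank ℂ L.F = 1)
    {j : ∀ x, L.fiber x →ₗ[ℂ] V.fiber x} (hj : IsContHom L V j) {x₀ : X}
    (hinj : Function.Injective (j x₀)) :
    ∃ q, IsContHom V L q ∧ (∀ x, 0 ≤ (LinearMap.trace ℂ _ (q x ∘ₗ j x)).re) ∧
      ∀ᶠ x in 𝓝 x₀, 0 < (LinearMap.trace ℂ _ (q x ∘ₗ j x)).re := by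
  have hJ : Function.Injective (coordAt L V x₀ x₀ (j x₀)) := fun a b h => by
    have h1 := hinj (co_injective (mem_base x₀) h)
    rw [← co_frame (V := L) (mem_base x₀) a, ← co_frame (V := L) (mem_base x₀) b, h1]
  obtain ⟨a, ha⟩ := LinearMap.exists_leftInverse_of_injective
    (coordAt L V x₀ x₀ (j x₀) : L.F →ₗ[ℂ] V.F) (LinearMap.ker_eq_bot.2 hJ)
  let a' : V.F →L[ℂ] L.F := LinearMap.toContinuousLinearMap a
  let t : X → ℝ := fun x =>
    (LinearMap.trace ℂ L.F (a ∘ₗ (coordAt L V x₀ x (j x) : L.F →ₗ[ℂ] V.F))).re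
  let l : (L.F →L[ℂ] V.F) →ₗ[ℂ] ℂ :=
    LinearMap.trace ℂ L.F ∘ₗ LinearMap.llcomp ℂ _ _ _ a ∘ₗ ContinuousLinearMap.coeLM ℂ
  have ht : ∀ x ∈ L.base x₀ ∩ V.base x₀, ContinuousAt t x := fun x hx =>
    Complex.continuous_re.continuousAt.comp
      (ContinuousAt.comp (f := fun x => coordAt L V x₀ x (j x)) (x := x)
        l.continuous_of_finiteDimensional.continuousAt (hj.continuousAt hx.1 hx.2))
  have ht0 : 0 < t x₀ := by
    simp only [t, ha, LinearMap.trace_id, hL]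
    simp
  have hopen : IsOpen (L.base x₀ ∩ V.base x₀) := (isOpen_base x₀).inter (isOpen_base x₀)
  -- Supporting the cut-off where `t` is positive keeps the trace nonnegative everywhere, so
  -- finitely many such maps can be added without cancellation.
  let U : Set X := {x | x ∈ L.base x₀ ∩ V.base x₀ ∧ 0 < t x}
  have hU : IsOpen U := isOpen_iff_mem_nhds.2 fun x hx =>
    Filter.inter_mem (hopen.mem_nhds hx.1) ((ht x hx.1).eventually_const_lt hx.2)
  obtain ⟨χ, hχs, hχ1, hχ⟩ := exists_tsupport_one_of_isOpen_isClosed hU isClosed_closure.isCompact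
    (isClosed_singleton (x := x₀)) (by
      rintro _ rfl
      exact ⟨⟨mem_base _, mem_base _⟩, ht0⟩)
  have htr : ∀ x ∈ U, (LinearMap.trace ℂ _ (uncoordAt V L x₀ x ((χ x : ℂ) • a') ∘ₗ j x)).re =
      χ x * t x := by
    rintro x ⟨⟨h1, h2⟩, -⟩
    rw [← trace_coordAt h1, coordAt_comp h2, coordAt_uncoordAt h2 h1]
    change (LinearMap.trace ℂ L.F ((χ x : ℂ) • (a ∘ₗ (coordAt L V x₀ x (j x) : L.F →ₗ[ℂ] V.F)))).re
      = _
    rw [map_smul, smul_eq_mul, Complex.re_ofReal_mul]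
  refine ⟨fun x => uncoordAt V L x₀ x ((χ x : ℂ) • a'), ?_, fun x => ?_, ?_⟩
  · refine isContHom_uncoordAt (by fun_prop) ?_
    have h1 : tsupport (fun x => (χ x : ℂ) • a') ⊆ tsupport χ := closure_mono fun x hx => by
      contrapose! hx
      simp [Function.notMem_support.1 hx]
    exact fun x hx => ⟨(hχs (h1 hx)).1.2, (hχs (h1 hx)).1.1⟩
  · by_cases hx : x ∈ U
    · rw [htr x hx]
      exact mul_nonneg (hχ x).1 hx.2.le
    · have : χ x = 0 := image_eq_zero_of_notMem_tsupport fun h => hx (hχs h)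
      simp [this]
  · have h1 : 0 < χ x₀ := by
      rw [hχ1 rfl]
      exact one_pos
    filter_upwards [hU.mem_nhds ⟨⟨mem_base _, mem_base _⟩, ht0⟩,
      χ.continuous.continuousAt.eventually_const_lt h1] with x hx hx'
    rw [htr x hx]
    exact mul_pos hx' hx.2

/-- An injective equivariant family of linear maps on a line bundle has an equivariant left
inverse. -/
theorem exists_leftInverse [T2Space X] [CompactSpace X] (hL : Module.finrank ℂ L.F = 1)
    {j : ∀ x, L.fiber x →ₗ[ℂ] V.fiber x} (hj : j ∈ equivariantHoms L V)
    (hinj : ∀ x, Function.Injective (j x)) :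
    ∃ q ∈ equivariantHoms V L, ∀ x, q x ∘ₗ j x = LinearMap.id := by
  obtain ⟨q, hq, -, hpos⟩ := isCompact_univ.induction_on
    (p := fun A : Set X => ∃ q, IsContHom V L q ∧
      (∀ x, 0 ≤ (LinearMap.trace ℂ _ (q x ∘ₗ j x)).re) ∧
      ∀ x ∈ A, 0 < (LinearMap.trace ℂ _ (q x ∘ₗ j x)).re)
    ⟨fun _ => 0, isContHom_zero, by simp, by simp⟩
    (fun A B hAB ⟨q, hq, h1, h2⟩ => ⟨q, hq, h1, fun x hx => h2 x (hAB hx)⟩)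
    (fun A B ⟨q, hq, h1, h2⟩ ⟨q', hq', h1', h2'⟩ => by
      refine ⟨_, hq.add hq', fun x => ?_, fun x hx => ?_⟩ <;>
        simp only [LinearMap.add_comp, map_add, Complex.add_re]
      · exact add_nonneg (h1 x) (h1' x)
      · rcases hx with hx | hx
        · exact add_pos_of_pos_of_nonneg (h2 x hx) (h1' x)
        · exact add_pos_of_nonneg_of_pos (h1 x) (h2' x hx))
    (fun x _ => by
      obtain ⟨q, hq, h1, h2⟩ := exists_local_trace_pos hL hj.1 (hinj x)
      exact ⟨_, mem_nhdsWithin_of_mem_nhds h2, q, hq, h1, fun y hy => hy⟩)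
  -- Symmetrizing replaces the trace of `q ∘ j` at `x` by its sum with the value at `f x`, so the
  -- real part stays positive.
  let q' : ∀ x, V.fiber x →ₗ[ℂ] L.fiber x := fun x => q x + conj V L q x
  have hq' : IsContHom V L q' := hq.add hq.conj
  have hqe : IsEquivariant V L q' := isEquivariant_add_conj q
  let t : X → ℂ := fun x => LinearMap.trace ℂ _ (q' x ∘ₗ j x)
  have htc : Continuous t := (hq'.comp hj.1).continuous_trace
  have htr : ∀ x, t x = LinearMap.trace ℂ _ (q x ∘ₗ j x) +
      LinearMap.trace ℂ _ (q (f.toFun x) ∘ₗ j (f.toFun x)) := fun x => by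
    have h := trace_conj_eq (fun x => q x ∘ₗ j x) x
    rw [conj_comp, isEquivariant_iff_conj.1 hj.2] at h
    simp only [t, q', LinearMap.add_comp, map_add, h]
  have ht0 : ∀ x, t x ≠ 0 := fun x h => by
    have h1 := congrArg Complex.re (htr x)
    rw [h, Complex.add_re, Complex.zero_re] at h1
    have := hpos x trivial
    have := hpos (f.toFun x) trivial
    linarith
  have htf : ∀ x, t (f.toFun x) = t x := fun x => by
    rw [htr, htr, f.involutive x, add_comm]
  refine ⟨fun x => (t x)⁻¹ • q' x, ⟨hq'.smul (htc.inv₀ ht0), hqe.smul fun x => by rw [htf]⟩,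
    fun x => ?_⟩
  have h1 : Module.finrank ℂ (L.fiber x) = 1 := (L.finrank_fiber x).trans hL
  -- An endomorphism of a line is multiplication by its trace, so dividing by `t` yields an exact
  -- left inverse.
  obtain ⟨c, hc, -⟩ := LinearMap.existsUnique_eq_smul_id_of_finrank_eq_one h1 (q' x ∘ₗ j x)
  have h2 : t x = c := by
    simp only [t, hc, map_smul, LinearMap.trace_id, h1]
    simp
  rw [LinearMap.smul_comp, hc, ← h2, smul_smul, inv_mul_cancel₀ (ht0 x), one_smul]

/-- A line subbundle splits off. -/
theorem exists_iso_sum [T2Space X] [CompactSpace X] (hL : Module.finrank ℂ L.F = 1) {d : ℕ}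
    (hV : Module.finrank ℂ V.F = d + 1) {j : ∀ x, L.fiber x →ₗ[ℂ] V.fiber x}
    (hj : j ∈ equivariantHoms L V) (hinj : ∀ x, Function.Injective (j x)) :
    ∃ V₁ : EquivariantBundle.{u, v} f, Module.finrank ℂ V₁.F = d ∧
      Nonempty (Iso V (L.sum V₁)) := by
  obtain ⟨q, hq, hqj⟩ := exists_leftInverse hL hj hinj
  have hqj' : ∀ x w, q x (j x w) = w := fun x w => LinearMap.congr_fun (hqj x) w
  have hqP : ∀ x v, q x (v - j x (q x v)) = 0 := fun x v => by rw [map_sub, hqj', sub_self]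
  let p : ∀ x, V.fiber x →ₗ[ℂ] V.fiber x := fun x => LinearMap.id - j x ∘ₗ q x
  have hidem : ∀ x v, p x (p x v) = p x v := fun x v => by
    simp only [p, LinearMap.sub_apply, LinearMap.id_apply, LinearMap.comp_apply, hqP, map_zero,
      sub_zero]
  let P : Projection V d :=
    { map := p
      idem := hidem
      isContHom := isContHom_id.sub (hj.1.comp hq.1)
      isEquivariant := isEquivariant_id.sub (hj.2.comp hq.2)
      -- The trace of `j ∘ q` equals that of `q ∘ j = id` on the line, so the rank is `(d + 1) - 1`.
      finrank_range := fun x => by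
        have h := finrank_range_eq_trace (hidem x)
        rw [show p x = LinearMap.id - j x ∘ₗ q x from rfl, map_sub,
          LinearMap.trace_comp_comm', hqj, LinearMap.trace_id, LinearMap.trace_id,
          finrank_fiber, finrank_fiber, hL, hV] at h
        push_cast at h
        rw [add_sub_cancel_right] at h
        exact_mod_cast h }
  refine ⟨P.bundle, P.finrank_bundle, nonempty_iso_of_bijective
    (g := fun x => (q x).prod ((p x).codRestrict
      (LinearMap.range (P.map x)) fun w => ⟨w, rfl⟩)) ?_ ?_ fun x => ⟨fun a b h => ?_, ?_⟩⟩
  · exact continuous_prod_mk L P.bundle hq.1 (P.isContHom_codRestrict P.isContHom fun x w => ⟨w, rfl⟩)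
  · exact fun x v => Prod.ext (hq.2 x v) (Subtype.ext (P.isEquivariant x v))
  · obtain ⟨h1, h2⟩ := Prod.ext_iff.1 h
    have h1' : q x a = q x b := h1
    have h2' : a - j x (q x a) = b - j x (q x b) := Subtype.ext_iff.1 h2
    rw [h1'] at h2'
    exact sub_left_injective h2'
  · rintro ⟨l, ⟨_, w, rfl⟩⟩
    have h1 : q x (j x l + P.map x w) = l := by
      rw [map_add, hqj']
      change l + q x (w - j x (q x w)) = l
      rw [hqP, add_zero]
    refine ⟨j x l + P.map x w, Prod.ext h1 (Subtype.ext ?_)⟩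
    change j x l + P.map x w - j x (q x (j x l + P.map x w)) = P.map x w
    rw [h1, add_sub_cancel_left]

end EquivariantBundle

/-! ### The representation on the fibre at a fixed point -/

namespace EquivariantBundle

variable {f : ContinuousInvolution X} {V W : EquivariantBundle.{u, v} f}

/-- The identification of the fibres at equal points. -/
def castEquiv (V : EquivariantBundle.{u, v} f) {x y : X} (h : x = y) :
    V.fiber x ≃ₗ[ℂ] V.fiber y := h ▸ LinearEquiv.refl ℂ (V.fiber x)

theorem mk_castEquiv {x y : X} (h : x = y) (v : V.fiber x) :
    (⟨y, V.castEquiv h v⟩ : V.Total) = ⟨x, v⟩ := by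
  subst h
  rfl

/-- The action of the involution on the fibre at a fixed point. -/
def fixMap (V : EquivariantBundle.{u, v} f) {x : X} (hx : f.toFun x = x) :
    V.fiber x →ₗ[ℂ] V.fiber x := (V.castEquiv hx).toLinearMap ∘ₗ V.lift x

theorem mk_fixMap {x : X} (hx : f.toFun x = x) (v : V.fiber x) :
    (⟨x, V.fixMap hx v⟩ : V.Total) = V.totalLift ⟨x, v⟩ := mk_castEquiv hx _

theorem fixMap_eq {x : X} (hx : f.toFun x = x) {v w : V.fiber x}
    (h : V.totalLift ⟨x, v⟩ = ⟨x, w⟩) : V.fixMap hx v = w :=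
  TotalSpace.mk_injective x ((mk_fixMap hx v).trans h)

theorem fixMap_fixMap {x : X} (hx : f.toFun x = x) (v : V.fiber x) :
    V.fixMap hx (V.fixMap hx v) = v :=
  fixMap_eq hx (by rw [mk_fixMap, totalLift_totalLift])

theorem conj_eq_of_fixMap {x : X} (hx : f.toFun x = x) {g : ∀ x, V.fiber x →ₗ[ℂ] W.fiber x}
    (h : ∀ v, g x (V.fixMap hx v) = W.fixMap hx (g x v)) : conj V W g x = g x := by
  ext v
  apply (W.lift_bijective x).1
  rw [lift_conj]
  apply TotalSpace.mk_injective (f.toFun x)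
  have h1 : (⟨f.toFun x, g (f.toFun x) (V.lift x v)⟩ : W.Total) = ⟨x, g x (V.fixMap hx v)⟩ :=
    congrArg (fun p : V.Total => (⟨p.proj, g p.proj p.snd⟩ : W.Total)) (mk_fixMap hx v).symm
  exact h1.trans ((congrArg (TotalSpace.mk x) (h v)).trans (mk_fixMap hx (g x v)))

theorem Iso.trace_fixMap (e : Iso V W) {x : X} (hx : f.toFun x = x) :
    LinearMap.trace ℂ _ (W.fixMap hx) = LinearMap.trace ℂ _ (V.fixMap hx) := by
  rw [← LinearMap.trace_conj' (V.fixMap hx) (e.equiv x)]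
  congr 1
  ext w
  obtain ⟨v, rfl⟩ := (e.equiv x).surjective w
  refine fixMap_eq hx ?_
  have h1 : W.totalLift ⟨x, e.equiv x v⟩ = ⟨f.toFun x, e.equiv _ (V.lift x v)⟩ :=
    congrArg (TotalSpace.mk (f.toFun x)) (e.map_lift x v).symm
  rw [h1, LinearEquiv.conj_apply_apply, LinearEquiv.symm_apply_apply]
  exact congrArg (fun p : V.Total => (⟨p.proj, e.equiv p.proj p.snd⟩ : W.Total))
    (mk_fixMap hx v).symm

theorem trace_fixMap_sum {x : X} (hx : f.toFun x = x) :
    LinearMap.trace ℂ _ ((V.sum W).fixMap hx) =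
      LinearMap.trace ℂ _ (V.fixMap hx) + LinearMap.trace ℂ _ (W.fixMap hx) := by
  rw [← LinearMap.trace_prodMap']
  congr 1
  refine LinearMap.ext fun p => fixMap_eq hx ?_
  have key : ∀ y (hy : f.toFun x = y), (⟨f.toFun x, (V.lift x p.1, W.lift x p.2)⟩ : (V.sum W).Total)
      = ⟨y, (V.castEquiv hy (V.lift x p.1), W.castEquiv hy (W.lift x p.2))⟩ := by
    rintro _ rfl
    rfl
  exact key x hx

/-- The projection to the invariant part of the fibre at a fixed point. -/
def plusMap (V : EquivariantBundle.{u, v} f) {x : X} (hx : f.toFun x = x) :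
    V.fiber x →ₗ[ℂ] V.fiber x := (2⁻¹ : ℂ) • (LinearMap.id + V.fixMap hx)

/-- The dimension of the invariant part of the fibre at a fixed point. -/
def plusRank (V : EquivariantBundle.{u, v} f) {x : X} (hx : f.toFun x = x) : ℕ :=
  Module.finrank ℂ (LinearMap.range (V.plusMap hx))

/-- `plusMap` is idempotent, so its rank is its trace. Thus the invariant dimension depends only on
the rank and on a trace that is additive and invariant under isomorphism. -/
theorem plusRank_eq {x : X} (hx : f.toFun x = x) :
    (V.plusRank hx : ℂ) =
      2⁻¹ * (Module.finrank ℂ V.F + LinearMap.trace ℂ _ (V.fixMap hx)) := by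
  rw [plusRank, finrank_range_eq_trace, plusMap, map_smul, map_add, LinearMap.trace_id,
    finrank_fiber, smul_eq_mul]
  intro v
  simp only [plusMap, LinearMap.smul_apply, LinearMap.add_apply, LinearMap.id_apply, map_smul,
    map_add, fixMap_fixMap]
  module

theorem fixMap_eq_neg_of_plusRank {x : X} (hx : f.toFun x = x) (h : V.plusRank hx = 0)
    (v : V.fiber x) : V.fixMap hx v = -v := by
  have h1 : V.plusMap hx = 0 := LinearMap.range_eq_bot.1 (Submodule.finrank_eq_zero.1 h)
  have h2 : (2⁻¹ : ℂ) • (v + V.fixMap hx v) = 0 := LinearMap.congr_fun h1 v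
  exact (neg_eq_of_add_eq_zero_right ((smul_eq_zero.1 h2).resolve_left (by norm_num))).symm

theorem exists_fixMap_eq_of_plusRank {x : X} (hx : f.toFun x = x) (h : V.plusRank hx ≠ 0) :
    ∃ v, v ≠ 0 ∧ V.fixMap hx v = v := by
  have h1 : V.plusMap hx ≠ 0 := fun h0 => h (by simp [plusRank, h0])
  obtain ⟨w, hw⟩ : ∃ w, V.plusMap hx w ≠ 0 := by
    by_contra! hw
    exact h1 (LinearMap.ext hw)
  refine ⟨_, hw, ?_⟩
  simp only [plusMap, LinearMap.smul_apply, LinearMap.add_apply, LinearMap.id_apply, map_smul,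
    map_add, fixMap_fixMap]
  rw [add_comm]

variable (V) in
/-- The fixed points over which the invariant part vanishes, and the other ones, are closed. -/
theorem isClosed_plusRank [T2Space X] :
    IsClosed {x | ∃ hx : f.toFun x = x, V.plusRank hx = 0} ∧
      IsClosed {x | ∃ hx : f.toFun x = x, V.plusRank hx ≠ 0} := by
  classical
  let B : Set X := {x | f.toFun x = x}
  have hB : IsClosed B := isClosed_eq f.continuous_toFun continuous_id
  let t : X → ℝ := fun x =>
    if hx : f.toFun x = x then (LinearMap.trace ℂ _ (V.fixMap hx)).re else 0
  have ht : ContinuousOn t B := by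
    intro x₀ hx₀
    -- Points near `x₀` need not be fixed, so coordinates are taken at `x` and at `f x` separately;
    -- on the fixed set `c x` is the matrix of `fixMap`.
    let c : X → (V.F →L[ℂ] V.F) := fun x => LinearMap.toContinuousLinearMap
      (V.co x₀ (f.toFun x) ∘ₗ V.lift x ∘ₗ V.frame x₀ x)
    have hc : ContinuousAt c x₀ := continuousAt_clm_apply.2 fun y => by
      have h1 : ContinuousAt (fun x : X => (⟨x, V.frame x₀ x y⟩ : V.Total)) x₀ :=
        ContinuousAt.comp (f := fun x : X => (x, y)) (x := x₀)
          (continuousAt_frame (q := (x₀, y)) (mem_base x₀)) (by fun_prop)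
      have h2 : ContinuousAt (fun x : X => V.totalLift ⟨x, V.frame x₀ x y⟩) x₀ :=
        ContinuousAt.comp (f := fun x : X => (⟨x, V.frame x₀ x y⟩ : V.Total)) (x := x₀)
          (Continuous.continuousAt V.continuous_lift) h1
      refine ContinuousAt.comp (f := fun x : X => V.totalLift ⟨x, V.frame x₀ x y⟩) (x := x₀)
        (g := fun p : V.Total => V.co x₀ p.proj p.snd) (continuousAt_co ?_) h2
      have : f.toFun x₀ ∈ V.base x₀ := by
        rw [show f.toFun x₀ = x₀ from hx₀]
        exact mem_base x₀
      exact this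
    let l : (V.F →L[ℂ] V.F) →ₗ[ℂ] ℂ := LinearMap.trace ℂ V.F ∘ₗ ContinuousLinearMap.coeLM ℂ
    have hlc : ContinuousAt (fun x => (l (c x)).re) x₀ := Complex.continuous_re.continuousAt.comp
      (ContinuousAt.comp (f := c) (x := x₀) l.continuous_of_finiteDimensional.continuousAt hc)
    refine hlc.continuousWithinAt.congr_of_eventuallyEq_of_mem ?_ hx₀
    filter_upwards [mem_nhdsWithin_of_mem_nhds (base_mem_nhds (mem_base (V := V) x₀)),
      self_mem_nhdsWithin] with x hx hxB
    simp only [t, dif_pos (show f.toFun x = x from hxB)]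
    rw [← LinearMap.trace_conj' _ (V.coEquiv hx)]
    refine congrArg (fun g => (LinearMap.trace ℂ V.F g).re) (LinearMap.ext fun y => ?_)
    exact congrArg (fun p : V.Total => V.co x₀ p.proj p.snd)
      (mk_fixMap hxB (V.frame x₀ x y))
  have key : ∀ x (hx : f.toFun x = x),
      (V.plusRank hx : ℝ) = 2⁻¹ * (Module.finrank ℂ V.F + t x) := fun x hx => by
    have h := congrArg Complex.re (V.plusRank_eq hx)
    simp only [t, dif_pos hx]
    simpa using h
  -- The invariant dimension is continuous on the fixed set and integral, so "zero" and "at least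
  -- one" are both closed conditions.
  have hc : ContinuousOn (fun x => 2⁻¹ * (Module.finrank ℂ V.F + t x)) B := by fun_prop
  constructor
  · convert hc.preimage_isClosed_of_isClosed hB (isClosed_singleton (x := (0 : ℝ))) using 1
    ext x
    constructor
    · rintro ⟨hx, h⟩
      exact ⟨hx, by simp [← key x hx, h]⟩
    · rintro ⟨hx, h⟩
      refine ⟨hx, ?_⟩
      have h' : 2⁻¹ * (Module.finrank ℂ V.F + t x) = 0 := h
      rw [← key x hx] at h'
      exact_mod_cast h'
  · convert hc.preimage_isClosed_of_isClosed hB (isClosed_Ici (a := (1 : ℝ))) using 1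
    ext x
    constructor
    · rintro ⟨hx, h⟩
      refine ⟨hx, ?_⟩
      change 1 ≤ 2⁻¹ * (Module.finrank ℂ V.F + t x)
      rw [← key x hx]
      exact_mod_cast Nat.one_le_iff_ne_zero.2 h
    · rintro ⟨hx, h⟩
      refine ⟨hx, ?_⟩
      have h' : 1 ≤ 2⁻¹ * (Module.finrank ℂ V.F + t x) := h
      rw [← key x hx] at h'
      exact Nat.one_le_iff_ne_zero.1 (by exact_mod_cast h')

/-- A nonzero equivariant homomorphism of fibres at a fixed point, out of a line. -/
theorem exists_conj_eq_of_fixMap {L V : EquivariantBundle.{u, v} f}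
    (hL : Module.finrank ℂ L.F = 1) {x : X} (hx : f.toFun x = x) {c : ℂ}
    (hLc : ∀ l, L.fixMap hx l = c • l) {v : V.fiber x} (hv : v ≠ 0)
    (hVc : V.fixMap hx v = c • v) :
    ∃ g : ∀ x, L.fiber x →ₗ[ℂ] V.fiber x, conj L V g x = g x ∧ g x ≠ 0 := by
  classical
  have h1 : Module.finrank ℂ (L.fiber x) = 1 := (L.finrank_fiber x).trans hL
  obtain ⟨φ⟩ := FiniteDimensional.nonempty_linearEquiv_of_finrank_eq
    (h1.trans (Module.finrank_self ℂ).symm)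
  let G : L.fiber x →ₗ[ℂ] V.fiber x := φ.toLinearMap.smulRight v
  refine ⟨Function.update (fun _ => 0) x G, conj_eq_of_fixMap hx fun l => ?_, fun h => ?_⟩
  · rw [Function.update_self, hLc, map_smul]
    simp only [G, LinearMap.smulRight_apply, map_smul, hVc]
    rw [smul_comm]
  · rw [Function.update_self] at h
    have h2 := LinearMap.congr_fun h (φ.symm 1)
    simp only [G, LinearMap.smulRight_apply, LinearEquiv.coe_coe, LinearEquiv.apply_symm_apply,
      one_smul, LinearMap.zero_apply] at h2
    exact hv h2

end EquivariantBundle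

/-! ### Determinants and cancellation in rank one -/

namespace EquivariantBundle

section Determinant

variable {M M' N : Type*} [AddCommGroup M] [Module ℂ M] [AddCommGroup M'] [Module ℂ M']
  [AddCommGroup N] [Module ℂ N]

/-- The determinant of an isomorphism `M × N ≃ M' × N` with respect to an isomorphism `M ≃ M'`. -/
def relDet (φ : (M × N) →ₗ[ℂ] (M' × N)) (θ : M ≃ₗ[ℂ] M') : ℂ :=
  LinearMap.det (θ.symm.toLinearMap.prodMap LinearMap.id ∘ₗ φ)

theorem relDet_ne_zero (φ : (M × N) ≃ₗ[ℂ] (M' × N)) (θ : M ≃ₗ[ℂ] M') :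
    relDet φ.toLinearMap θ ≠ 0 :=
  (LinearEquiv.isUnit_det' (φ.trans (θ.symm.prodCongr (LinearEquiv.refl ℂ N)))).ne_zero

/-- Naturality of the determinant under changes of basis that act on `N` in the same way in source
and target. It serves both for local coordinates and for equivariance. -/
theorem relDet_conj {M₁ M₁' N₁ : Type*} [AddCommGroup M₁] [Module ℂ M₁] [AddCommGroup M₁']
    [Module ℂ M₁'] [AddCommGroup N₁] [Module ℂ N₁] (φ : (M × N) →ₗ[ℂ] (M' × N))
    (φ₁ : (M₁ × N₁) →ₗ[ℂ] (M₁' × N₁)) (a : M ≃ₗ[ℂ] M₁) (a' : M' ≃ₗ[ℂ] M₁') (b : N ≃ₗ[ℂ] N₁)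
    (h : ∀ p, φ₁ (a p.1, b p.2) = (a' (φ p).1, b (φ p).2)) (θ : M ≃ₗ[ℂ] M') :
    relDet φ₁ (a.symm.trans (θ.trans a')) = relDet φ θ := by
  rw [relDet, relDet, ← LinearMap.det_conj _ (a.prodCongr b)]
  congr 1
  refine LinearMap.ext fun p => ?_
  obtain ⟨p, rfl⟩ := (a.prodCongr b).surjective p
  simp only [LinearMap.comp_apply, LinearEquiv.coe_coe, LinearEquiv.symm_apply_apply]
  rw [show (a.prodCongr b) p = (a p.1, b p.2) from rfl, h]
  simp

/-- For lines, `θ' = c θ` divides the determinant by `c`, so the product does not change. It is the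
canonical map `M → M'` induced by `det φ`. -/
theorem relDet_smul_indep [FiniteDimensional ℂ N] (hM : Module.finrank ℂ M = 1)
    (φ : (M × N) →ₗ[ℂ] (M' × N)) (θ θ' : M ≃ₗ[ℂ] M') :
    relDet φ θ • θ.toLinearMap = relDet φ θ' • θ'.toLinearMap := by
  have : FiniteDimensional ℂ M := Module.finite_of_finrank_pos (by rw [hM]; exact one_pos)
  obtain ⟨c, hc, -⟩ := LinearMap.existsUnique_eq_smul_id_of_finrank_eq_one hM
    (θ'.trans θ.symm).toLinearMap
  have h1 : ∀ v, θ' v = c • θ v := fun v => by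
    have := congrArg θ (LinearMap.congr_fun hc v)
    simpa using this
  have h2 : ∀ w, θ.symm w = c • θ'.symm w := fun w => by
    obtain ⟨v, rfl⟩ := θ'.surjective w
    rw [h1 v, map_smul, LinearEquiv.symm_apply_apply, ← h1, LinearEquiv.symm_apply_apply]
  have h3 : relDet φ θ = c * relDet φ θ' := by
    have e : θ.symm.toLinearMap.prodMap LinearMap.id ∘ₗ φ =
        (c • (LinearMap.id : M →ₗ[ℂ] M)).prodMap (LinearMap.id : N →ₗ[ℂ] N) ∘ₗ
          (θ'.symm.toLinearMap.prodMap LinearMap.id ∘ₗ φ) := by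
      refine LinearMap.ext fun p => Prod.ext ?_ rfl
      exact h2 _
    rw [relDet, e, LinearMap.det_comp, LinearMap.det_prodMap, LinearMap.det_smul, hM, relDet]
    simp
  ext v
  simp only [LinearMap.smul_apply, LinearEquiv.coe_coe, h1 v, h3, smul_smul]
  rw [mul_comm]

end Determinant

variable {f : ContinuousInvolution X} {V V' W : EquivariantBundle.{u, v} f}

theorem isContHom_fst (V W : EquivariantBundle.{u, v} f) :
    IsContHom (V.sum W) V (fun _ => LinearMap.fst ℂ _ _) := continuous_prod_fst V W

theorem isContHom_snd (V W : EquivariantBundle.{u, v} f) :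
    IsContHom (V.sum W) W (fun _ => LinearMap.snd ℂ _ _) := continuous_prod_snd V W

theorem isContHom_inl (V W : EquivariantBundle.{u, v} f) :
    IsContHom V (V.sum W) (fun _ => LinearMap.inl ℂ _ _) :=
  continuous_prod_mk V W isContHom_id isContHom_zero

theorem isContHom_inr (V W : EquivariantBundle.{u, v} f) :
    IsContHom W (V.sum W) (fun _ => LinearMap.inr ℂ _ _) :=
  continuous_prod_mk V W isContHom_zero isContHom_id

/-- Cancellation for equivariant line bundles. -/
theorem nonempty_iso_of_finrank_eq_one (hV : Module.finrank ℂ V.F = 1)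
    (hV' : Module.finrank ℂ V'.F = 1) (e : Iso (V.sum W) (V'.sum W)) : Nonempty (Iso V V') := by
  have hfV : ∀ x, Module.finrank ℂ (V.fiber x) = 1 := fun x => (V.finrank_fiber x).trans hV
  have hfV' : ∀ x, Module.finrank ℂ (V'.fiber x) = 1 := fun x => (V'.finrank_fiber x).trans hV'
  have hθ : ∀ x, Nonempty (V.fiber x ≃ₗ[ℂ] V'.fiber x) := fun x =>
    FiniteDimensional.nonempty_linearEquiv_of_finrank_eq ((hfV x).trans (hfV' x).symm)
  obtain ⟨θ₀⟩ : Nonempty (V.F ≃ₗ[ℂ] V'.F) :=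
    FiniteDimensional.nonempty_linearEquiv_of_finrank_eq (hV.trans hV'.symm)
  let φ : ∀ x, (V.fiber x × W.fiber x) ≃ₗ[ℂ] (V'.fiber x × W.fiber x) := e.equiv
  -- The choice of `θ` at each point is arbitrary and not continuous; by independence it can be
  -- replaced below by one suited to each verification.
  let ψ : ∀ x, V.fiber x →ₗ[ℂ] V'.fiber x := fun x =>
    relDet (φ x).toLinearMap (hθ x).some • (hθ x).some.toLinearMap
  have hψ : ∀ x (θ : V.fiber x ≃ₗ[ℂ] V'.fiber x), ψ x = relDet (φ x).toLinearMap θ • θ.toLinearMap :=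
    fun x θ => relDet_smul_indep (hfV x) _ _ _
  have hφ : IsContHom (V.sum W) (V'.sum W) (fun x => (φ x).toLinearMap) := e.continuous_toFun
  refine nonempty_iso_of_bijective (g := ψ) (isContHom_of_coordAt fun x₀ => ?_) (fun x v => ?_)
    fun x => ?_
  · have hbV := mem_base (V := V) x₀
    have hbV' := mem_base (V := V') x₀
    have hbW := mem_base (V := W) x₀
    have c₁ := (((isContHom_fst V' W).comp hφ).comp (isContHom_inl V W)).continuousAt hbV hbV'
    have c₂ := (((isContHom_fst V' W).comp hφ).comp (isContHom_inr V W)).continuousAt hbW hbV'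
    have c₃ := (((isContHom_snd V' W).comp hφ).comp (isContHom_inl V W)).continuousAt hbV hbW
    have c₄ := (((isContHom_snd V' W).comp hφ).comp (isContHom_inr V W)).continuousAt hbW hbW
    -- The block matrix of `φ` in the trivializations of the summands.
    let Φ : ∀ x, (V.F × W.F) →L[ℂ] (V'.F × W.F) := fun x =>
      ((coordAt V V' x₀ x (LinearMap.fst ℂ _ _ ∘ₗ (φ x).toLinearMap ∘ₗ LinearMap.inl ℂ _ _)).coprod
        (coordAt W V' x₀ x (LinearMap.fst ℂ _ _ ∘ₗ (φ x).toLinearMap ∘ₗ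
          LinearMap.inr ℂ _ _))).prod
      ((coordAt V W x₀ x (LinearMap.snd ℂ _ _ ∘ₗ (φ x).toLinearMap ∘ₗ LinearMap.inl ℂ _ _)).coprod
        (coordAt W W x₀ x (LinearMap.snd ℂ _ _ ∘ₗ (φ x).toLinearMap ∘ₗ LinearMap.inr ℂ _ _)))
    have hΦ : ContinuousAt Φ x₀ := continuousAt_clm_apply.2 fun y =>
      ((c₁.clm_apply continuousAt_const).add (c₂.clm_apply continuousAt_const)).prodMk
        ((c₃.clm_apply continuousAt_const).add (c₄.clm_apply continuousAt_const))
    let Θ : (V'.F × W.F) →L[ℂ] (V.F × W.F) :=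
      LinearMap.toContinuousLinearMap (θ₀.symm.toLinearMap.prodMap LinearMap.id)
    have hdet : ContinuousAt (fun x => (Θ ∘L Φ x).det) x₀ :=
      ContinuousLinearMap.continuous_det.continuousAt.comp (continuousAt_const.clm_comp hΦ)
    refine (hdet.smul (continuousAt_const (y := LinearMap.toContinuousLinearMap
      θ₀.toLinearMap))).congr ?_
    filter_upwards [base_mem_nhds hbV, base_mem_nhds hbV', base_mem_nhds hbW] with x h₁ h₂ h₃
    have hrel := relDet_conj (φ x).toLinearMap (Φ x : (V.F × W.F) →ₗ[ℂ] (V'.F × W.F))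
      (V.coEquiv h₁) (V'.coEquiv h₂) (W.coEquiv h₃) (fun p => by
        have hp : φ x p = φ x (p.1, 0) + φ x (0, p.2) := by
          rw [← map_add, Prod.mk_add_mk, add_zero, zero_add]
        refine Prod.ext ?_ ?_
        · change V'.co x₀ x (φ x (V.frame x₀ x (V.co x₀ x p.1), 0)).1 +
            V'.co x₀ x (φ x (0, W.frame x₀ x (W.co x₀ x p.2))).1 = V'.co x₀ x (φ x p).1
          rw [frame_co h₁, frame_co h₃, hp, Prod.fst_add, map_add]
        · change W.co x₀ x (φ x (V.frame x₀ x (V.co x₀ x p.1), 0)).2 +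
            W.co x₀ x (φ x (0, W.frame x₀ x (W.co x₀ x p.2))).2 = W.co x₀ x (φ x p).2
          rw [frame_co h₁, frame_co h₃, hp, Prod.snd_add, map_add])
      (((V.coEquiv h₁).trans θ₀).trans (V'.coEquiv h₂).symm)
    have hθ' : (V.coEquiv h₁).symm.trans ((((V.coEquiv h₁).trans θ₀).trans
        (V'.coEquiv h₂).symm).trans (V'.coEquiv h₂)) = θ₀ := by
      ext y
      simp
    rw [hθ'] at hrel
    ext y
    rw [hψ x (((V.coEquiv h₁).trans θ₀).trans (V'.coEquiv h₂).symm), map_smul, ← hrel]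
    refine congrArg (fun z : V'.F =>
      relDet (Φ x : (V.F × W.F) →ₗ[ℂ] (V'.F × W.F)) θ₀ • z) ?_
    change θ₀ y = V'.co x₀ x (V'.frame x₀ x (θ₀ (V.co x₀ x (V.frame x₀ x y))))
    rw [co_frame h₁, co_frame h₂]
  · obtain ⟨θ⟩ := hθ x
    -- At `f x`, the comparison map is the transport of `θ` by the lifts; the lift on `W` occurs on
    -- both sides and leaves the determinant unchanged.
    rw [hψ x θ, hψ (f.toFun x) ((V.liftEquiv x).symm.trans (θ.trans (V'.liftEquiv x))),
      relDet_conj (φ x).toLinearMap _ _ _ (W.liftEquiv x) (fun p => e.map_lift x p)]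
    rw [← V.liftEquiv_apply, ← V'.liftEquiv_apply]
    simp
  · rw [hψ x (hθ x).some]
    have h0 := relDet_ne_zero (φ x) (hθ x).some
    constructor
    · intro a b h
      exact (hθ x).some.injective (smul_right_injective _ h0 h)
    · intro w
      refine ⟨(hθ x).some.symm ((relDet (φ x).toLinearMap (hθ x).some)⁻¹ • w), ?_⟩
      simp [smul_smul, h0]

end EquivariantBundle

/-! ### Cancellation and the Grothendieck group -/

namespace EquivariantBundle

variable {f : ContinuousInvolution X} {V V' W : EquivariantBundle.{u, v} f}

theorem finrank_eq_of_iso_sum [Nonempty X] (e : Iso (V.sum W) (V'.sum W)) :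
    Module.finrank ℂ V.F = Module.finrank ℂ V'.F := by
  obtain ⟨x⟩ := ‹Nonempty X›
  have φ : (V.fiber x × W.fiber x) ≃ₗ[ℂ] (V'.fiber x × W.fiber x) := e.equiv x
  have h := φ.finrank_eq
  rw [Module.finrank_prod, Module.finrank_prod, V.finrank_fiber, V'.finrank_fiber,
    W.finrank_fiber] at h
  omega

/-- The trace contribution of `W` cancels. Hence one choice of signs for `L` suits both bundles. -/
theorem plusRank_eq_of_iso_sum (e : Iso (V.sum W) (V'.sum W)) {x : X} (hx : f.toFun x = x) :
    V'.plusRank hx = V.plusRank hx := by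
  have : Nonempty X := ⟨x⟩
  have h := e.trace_fixMap hx
  rw [trace_fixMap_sum, trace_fixMap_sum, add_left_inj] at h
  have h1 : (V'.plusRank hx : ℂ) = V.plusRank hx := by
    rw [plusRank_eq, plusRank_eq, h, finrank_eq_of_iso_sum e]
  exact_mod_cast h1

/-- A line bundle with the right signs over the fixed point set splits off from a bundle of rank at
least two. -/
theorem exists_iso_sum_of_signs [T2Space X] [CompactSpace X] [ChartedSpace ℂ X]
    (hf : IsAntiholomorphic f.toFun) {L V : EquivariantBundle.{u, v} f}
    (hL : Module.finrank ℂ L.F = 1) {n : ℕ} (hV : Module.finrank ℂ V.F = n + 2)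
    (h₁ : ∀ x (hx : f.toFun x = x), V.plusRank hx = 0 → ∀ l, L.fixMap hx l = -l)
    (h₂ : ∀ x (hx : f.toFun x = x), V.plusRank hx ≠ 0 → ∀ l, L.fixMap hx l = l) :
    ∃ V₁ : EquivariantBundle.{u, v} f, Module.finrank ℂ V₁.F = n + 1 ∧
      Nonempty (Iso V (L.sum V₁)) := by
  obtain ⟨j, hj, hj0⟩ := exists_equivariantHom_ne_zero (V := L) (W := V) hf
    (by rw [hL, hV]; omega) (fun x hx => by
      by_cases h : V.plusRank hx = 0
      -- Here the involution is `-1` on the whole fibre, as on `L`, so any nonzero vector serves.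
      · have : Nontrivial (V.fiber x) :=
          Module.nontrivial_of_finrank_pos (R := ℂ) (by rw [finrank_fiber, hV]; omega)
        obtain ⟨v, hv⟩ := exists_ne (0 : V.fiber x)
        exact exists_conj_eq_of_fixMap hL hx (c := -1)
          (fun l => by rw [h₁ x hx h, neg_one_smul]) hv
          (by rw [fixMap_eq_neg_of_plusRank hx h, neg_one_smul])
      · obtain ⟨v, hv, hvv⟩ := exists_fixMap_eq_of_plusRank hx h
        exact exists_conj_eq_of_fixMap hL hx (c := 1)
          (fun l => by rw [h₂ x hx h, one_smul]) hv (by rw [hvv, one_smul]))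
  refine exists_iso_sum hL hV hj fun x => ?_
  rw [injective_iff_map_eq_zero]
  intro l hl
  by_contra hl0
  refine hj0 x (LinearMap.ext fun l' => ?_)
  obtain ⟨c, rfl⟩ := (finrank_eq_one_iff_of_nonzero' l hl0).1 ((L.finrank_fiber x).trans hL) l'
  rw [map_smul, hl, smul_zero, LinearMap.zero_apply]

/-- Cancellation for equivariant bundles over a compact surface with an antiholomorphic
involution. -/
theorem nonempty_iso_of_iso_sum [T2Space X] [CompactSpace X] [Nonempty X] [ChartedSpace ℂ X]
    (hf : IsAntiholomorphic f.toFun) (n : ℕ) :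
    ∀ V V' W : EquivariantBundle.{u, v} f, Module.finrank ℂ V.F = n →
      Iso (V.sum W) (V'.sum W) → Nonempty (Iso V V') := by
  induction n with
  | zero =>
    intro V V' W hV e
    have hV' := (finrank_eq_of_iso_sum e).symm.trans hV
    have hs : ∀ x, Subsingleton (V.fiber x) := fun x =>
      Module.finrank_zero_iff.1 ((V.finrank_fiber x).trans hV)
    have hs' : ∀ x, Subsingleton (V'.fiber x) := fun x =>
      Module.finrank_zero_iff.1 ((V'.finrank_fiber x).trans hV')
    exact nonempty_iso_of_bijective (g := fun _ => 0) isContHom_zero (fun x v => by simp)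
      fun x => ⟨Function.injective_of_subsingleton _, fun w => ⟨0, Subsingleton.elim _ _⟩⟩
  | succ n ih =>
    intro V V' W hV e
    have hV' := (finrank_eq_of_iso_sum e).symm.trans hV
    -- Rank one is separate: general position off the fixed set needs `Hom(L, V)` of complex rank at
    -- least two.
    rcases n with _ | n
    · exact nonempty_iso_of_finrank_eq_one hV hV' e
    obtain ⟨hc₁, hc₂⟩ := V.isClosed_plusRank
    obtain ⟨L, hL, hL₁, hL₂⟩ := exists_lineBundle.{u, v} f hc₁ hc₂
      (Set.disjoint_left.2 fun x ⟨_, h⟩ ⟨_, h'⟩ => h' h) (by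
        ext x
        constructor
        · rintro (⟨hx, -⟩ | ⟨hx, -⟩) <;> exact hx
        · intro hx
          by_cases h : V.plusRank hx = 0
          · exact Or.inl ⟨hx, h⟩
          · exact Or.inr ⟨hx, h⟩)
    have h₁ : ∀ x (hx : f.toFun x = x), V.plusRank hx = 0 → ∀ l, L.fixMap hx l = -l :=
      fun x hx h l => fixMap_eq hx (hL₁ x ⟨hx, h⟩ l)
    have h₂ : ∀ x (hx : f.toFun x = x), V.plusRank hx ≠ 0 → ∀ l, L.fixMap hx l = l :=
      fun x hx h l => fixMap_eq hx (hL₂ x ⟨hx, h⟩ l)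
    obtain ⟨V₁, hV₁, ⟨i⟩⟩ := exists_iso_sum_of_signs hf hL hV h₁ h₂
    obtain ⟨V₁', -, ⟨i'⟩⟩ := exists_iso_sum_of_signs hf hL hV'
      (fun x hx h => h₁ x hx (by rwa [plusRank_eq_of_iso_sum e hx] at h))
      (fun x hx h => h₂ x hx (by rwa [plusRank_eq_of_iso_sum e hx] at h))
    -- `L` is absorbed into the auxiliary summand, which is why the induction quantifies over `W`.
    have hswap : ∀ U : EquivariantBundle.{u, v} f,
        Nonempty (Iso ((L.sum U).sum W) (U.sum (L.sum W))) := fun U =>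
      ⟨(Iso.sum (Iso.sumComm L U) (Iso.refl W)).trans (Iso.sumAssoc U L W)⟩
    obtain ⟨a⟩ := hswap V₁
    obtain ⟨a'⟩ := hswap V₁'
    obtain ⟨k⟩ := ih V₁ V₁' (L.sum W) hV₁ ((a.symm.trans (Iso.sum i.symm (Iso.refl W))).trans
      (e.trans ((Iso.sum i' (Iso.refl W)).trans a')))
    exact ⟨i.trans ((Iso.sum (Iso.refl L) k).trans i'.symm)⟩

/-- The Grothendieck group is the localization of the monoid at all its elements, where equality is
witnessed by adding a common element. -/
theorem kClass_eq_iff : V.kClass = V'.kClass ↔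
    ∃ W : EquivariantBundle.{u, v} f, Nonempty (Iso (V.sum W) (V'.sum W)) := by
  have h : V.kClass = V'.kClass ↔ ∃ c : (⊤ : AddSubmonoid (EquivariantVect.{u, v} f)),
      (c : EquivariantVect.{u, v} f) + V.isoClass = c + V'.isoClass :=
    (AddLocalization.addMonoidOf (⊤ : AddSubmonoid (EquivariantVect.{u, v} f))).eq_iff_exists
  rw [h]
  constructor
  · rintro ⟨⟨c, hm⟩, hc⟩
    obtain ⟨W, rfl⟩ : ∃ W : EquivariantBundle.{u, v} f, W.isoClass = c := Quotient.exists_rep c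
    rw [add_comm _ V.isoClass, add_comm _ V'.isoClass] at hc
    exact ⟨W, Quotient.exact hc⟩
  · rintro ⟨W, hW⟩
    refine ⟨⟨W.isoClass, AddSubmonoid.mem_top _⟩, ?_⟩
    rw [add_comm _ V.isoClass, add_comm _ V'.isoClass]
    exact Quotient.sound hW

end EquivariantBundle

end

theorem proposition4p1 {S : Type u} [TopologicalSpace S] [T2Space S] [CompactSpace S]
    [ConnectedSpace S] [ChartedSpace ℂ S] [IsManifold 𝓘(ℂ, ℂ) ω S]
    (f : ContinuousInvolution S) (hf : IsAntiholomorphic f.toFun)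
    (V V' : EquivariantBundle.{u, v} f) :
    Nonempty (EquivariantBundle.Iso V V') ↔ V.kClass = V'.kClass := by
  constructor
  · intro h
    exact congrArg Algebra.GrothendieckAddGroup.of (Quotient.sound h)
  · intro h
    obtain ⟨W, ⟨e⟩⟩ := EquivariantBundle.kClass_eq_iff.1 h
    exact EquivariantBundle.nonempty_iso_of_iso_sum hf _ V V' W rfl e
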